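/- Let $p$ be a prime, $r\ge 1$, and let $\mathbb Z_{p^r}$ be the ring of integers modulo $p^r$; for $0\le s\le r$ and $a\in\mathbb Z_{p^r}$ let $[a]_s\in\{0,\dots,p^s-1\}$ be the residue of $a$ modulo $p^s$. Entropies $H$ are in bits. A sequence $\mathbf x\in\mathcal X^n$ over a finite set $\mathcal X$ is $\epsilon$-typical with respect to a distribution $P$ on $\mathcal X$ if every $a\in\mathcal X$ satisfies $|\tfrac1n N(a|\mathbf x)-P(a)|\le \epsilon/|\mathcal X|$, where $N(a|\mathbf x)$ is the number of occurrences of $a$ in $\mathbf x$, and no $a$ with $P(a)=0$ occurs in $\mathbf x$. The set of these sequences is $A^{(n)}_\epsilon(P)$, also written $A^{(n)}_\epsilon(X)$ when $X\sim P$; similarly $A^{(n)}_\epsilon(X,Y)$ for the pair $(X,Y)$, viewed as one random variable with values in $\mathcal X\times\mathcal Y$. Let $(U,Q)$ be a pair of random variables with values in $\mathbb Z_{p^r}\times\mathcal Q$, where $\mathcal Q$ is finite and $P_Q(q)>0$ for all $q\in\mathcal Q$. Let $P_X$ be a distribution on $\mathbb Z_{p^r}$, let $P_{Y|X}(\cdot|x)$,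 $x\in\mathbb Z_{p^r}$, be distributions on a finite set $\mathcal Y$, and let $(X,Y)\sim P_XP_{Y|X}$. Let $c>0$. For each $n$ let the integers $k_q=k_q(n)$, $q\in\mathcal Q$, be $c\,n\,P_Q(q)$, rounded up or down if this is not an integer, and put $k_n=\sum_q k_q$. For $\epsilon>0$ let $\mathcal U_n=\prod_{q\in\mathcal Q}A^{(k_q)}_\epsilon(P_{U|Q=q})\subseteq\mathbb Z_{p^r}^{k_n}$. Given $\mathbf G\in\mathbb Z_{p^r}^{k_n\times n}$ and $\mathbf b\in\mathbb Z_{p^r}^n$, the codeword of $\mathbf u\in\mathcal U_n$ is $\mathbf c_n(\mathbf u)=\mathbf u\mathbf G+\mathbf b$, the quasi group code is $\mathcal C_n=\{\mathbf c_n(\mathbf u):\mathbf u\in\mathcal U_n\}$, and its rate is $R_n=\frac1n\log_2|\mathcal C_n|$. Then there is a function $\eta$, depending only on $P_{UQ}$, $P_X$, $P_{Y|X}$ and $c$, with $\eta(\epsilon)\to0$ as $\epsilon\downarrow0$, such that the following holds. For all $\epsilon>0$ and $\delta>0$ there is $N$ such that for all $n>N$ and all $\boldsymbol\theta\in\mathcal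 U_n$: if the pair $(\mathbf G,\mathbf b)$ is uniformly distributed over $\mathbb Z_{p^r}^{k_n\times n}\times\mathbb Z_{p^r}^n$, and if $\tilde{\mathbf Y}^n$ is a random sequence which, given $\mathbf c_n(\boldsymbol\theta)$, has the distribution $\prod_{i=1}^nP_{Y|X}(\tilde y_i|c_{n,i}(\boldsymbol\theta))$ and is conditionally independent of all other codewords, then $$P\Big\{R_n<\min_{0\le s\le r-1}\frac{H(U|Q)}{H(U|Q,[U]_s)}\big(\log_2p^{r-s}-H(X|Y,[X]_s)+\eta(\epsilon)\big)\ \text{ and }\ \exists\,\mathbf x\in\mathcal C_n:\ (\mathbf x,\tilde{\mathbf Y}^n)\in A^{(n)}_\epsilon(X,Y),\ \mathbf x\ne\mathbf c_n(\boldsymbol\theta)\Big\}<\delta ,$$ where the indices $s$ with $H(U|Q,[U]_s)=0$ are omitted from the minimum (which is $+\infty$ if none is left). In particular, if the bound on $R_n$ holds almost surely, then $$P\{\exists\,\mathbf x\in\mathcal C_n:\ (\mathbf x,\tilde{\mathbf Y}^n)\in A^{(n)}_\epsilon(X,Y),\ \mathbf x\ne\mathbf c_n(\boldsymbol\theta)\}<\delta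 .$$ -/

import Mathlib

open scoped BigOperators Topology

noncomputable section

namespace QGC

/-- The pair `(A, B)` where `A` has law `P` and, given `A = a`, `B` has law `K a`. -/
def pairLaw {α β : Type*} (P : PMF α) (K : α → PMF β) : PMF (α × β) :=
  P.bind fun a => (K a).map fun b => (a, b)

/-- Conditional entropy in bits, `H(f | g) = - ∑ P(f=a, g=b) log₂ P(f=a | g=b)`,
where the terms with `P(f=a, g=b) = 0` vanish. -/
def condEntropy {S α β : Type*} [Fintype α] [Fintype β] (P : PMF S) (f : S → α) (g : S → β) : ℝ :=
  - ∑ a, ∑ b, ((P.map fun t => (f t, g t)) (a, b)).toReal *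
      Real.logb 2 (((P.map fun t => (f t, g t)) (a, b)).toReal / ((P.map g) b).toReal)

/-- `[a]_s`: the representative in `{0, …, p^s - 1}` of `a ∈ ℤ/p^r` modulo `p^s ℤ/p^r`. -/
def trunc (p r s : ℕ) (a : ZMod (p ^ r)) : ZMod (p ^ r) := ((a.val % p ^ s : ℕ) : ZMod (p ^ r))

open Classical in
/-- The number of occurrences of the letter `a` in the sequence `x`. -/
def occ {α : Type*} {n : ℕ} (a : α) (x : Fin n → α) : ℕ :=
  (Finset.univ.filter fun i => x i = a).card

/-- The set of `ε`-typical sequences of length `n` with respect to `P`. -/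
def typicalSet {α : Type*} [Fintype α] (P : PMF α) (ε : ℝ) (n : ℕ) : Set (Fin n → α) :=
  {x | ∀ a, |(occ a x : ℝ) / n - (P a).toReal| ≤ ε / Fintype.card α ∧
    (P a = 0 → occ a x = 0)}

section Code

variable {p r : ℕ} [Fact p.Prime] {𝒬 : Type*}

/-- The index set `⨂_q A_ε^{(k_q)}(U_q)`, where `U_q` has law `PU q`. The coordinates of an
index vector are arranged in blocks, the block of `q` having length `k q`. -/
def indexSet (PU : 𝒬 → PMF (ZMod (p ^ r))) (ε : ℝ) (k : 𝒬 → ℕ) :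
    Set ((Σ q, Fin (k q)) → ZMod (p ^ r)) :=
  {u | ∀ q, (fun i => u ⟨q, i⟩) ∈ typicalSet (PU q) ε (k q)}

/-- The codeword `u G + b`. -/
def codeword [Fintype 𝒬] {n : ℕ} {k : 𝒬 → ℕ}
    (G : Matrix (Σ q, Fin (k q)) (Fin n) (ZMod (p ^ r))) (b : Fin n → ZMod (p ^ r))
    (u : (Σ q, Fin (k q)) → ZMod (p ^ r)) : Fin n → ZMod (p ^ r) :=
  Matrix.vecMul u G + b

/-- The quasi group code `{u G + b : u ∈ 𝒰}`. -/
def code [Fintype 𝒬] {n : ℕ} {k : 𝒬 → ℕ} (PU : 𝒬 → PMF (ZMod (p ^ r))) (ε : ℝ)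
    (G : Matrix (Σ q, Fin (k q)) (Fin n) (ZMod (p ^ r))) (b : Fin n → ZMod (p ^ r)) :
    Set (Fin n → ZMod (p ^ r)) :=
  codeword G b '' indexSet PU ε k

end Code

/-- The rate `(1/n) log₂ |C|` of a code of length `n`. -/
def rate {α : Type*} {n : ℕ} (C : Set (Fin n → α)) : ℝ := Real.logb 2 (C.ncard : ℝ) / n

/-- `Z` is a random variable, uniformly distributed over the finite type `α`. -/
def IsUniformRV {Ω α : Type*} [MeasurableSpace Ω] [Finite α] (μ : MeasureTheory.Measure Ω)
    (Z : Ω → α) : Prop :=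
  ∀ a, MeasurableSet (Z ⁻¹' {a}) ∧ μ.real (Z ⁻¹' {a}) = 1 / Nat.card α

/-- `Y` is a random sequence which, given the family `(c u)` for `u ∈ 𝒰`, is distributed as
`∏ i, W (· | (c u₀) i)`. That is: given `c u₀` it is the output of the memoryless channel `W`
for the input `c u₀`, and it is conditionally independent of the other `c u`. -/
def IsChannelOutput {Ω ι 𝒳 𝒴 : Type*} [MeasurableSpace Ω] {n : ℕ} (μ : MeasureTheory.Measure Ω)
    (W : 𝒳 → PMF 𝒴) (𝒰 : Set ι) (c : ι → Ω → (Fin n → 𝒳)) (u₀ : ι) (Y : Ω → (Fin n → 𝒴)) :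
    Prop :=
  (∀ y, MeasurableSet (Y ⁻¹' {y})) ∧
  ∀ (f : ι → (Fin n → 𝒳)) (y : Fin n → 𝒴),
    μ.real {ω | (∀ u ∈ 𝒰, c u ω = f u) ∧ Y ω = y} =
      μ.real {ω | ∀ u ∈ 𝒰, c u ω = f u} * ∏ i, (W (f u₀ i) (y i)).toReal

end QGC

end

/-!
If two index vectors `u`, `v` first differ at level `s`, that is, if `p ^ s` is the largest power
of `p` dividing `u - v`, then the differences of their codewords take each value with probability
at most `p ^ (-(r - s) n)`. Put `a_s = log₂ p^(r - s)`, `h_s = H(X|Y,[X]_s)`, `H_s = H(U|Q,[U]_s)`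
and `H = H(U|Q)`. There are about `2 ^ (n c H_s)` index vectors `v` which agree with `u` modulo
`p ^ s`, and about `2 ^ (n h_s)` sequences which agree with the codeword of `u` modulo `p ^ s` and
are typical with the output, while codewords at level `s` are uniform on `2 ^ (n a_s)` sequences.

If `c H_s` is below `a_s - h_s` at each level, the union bound gives the claim without any
condition on the rate. Otherwise `c H_t > a_t - h_t` at some level `t`, and the rate condition
forces the code to be much smaller than the index set. Such a loss requires many collisions
`c(u) = c(v)`: by the Cauchy-Schwarz inequality, `|𝒰|²` is at most the size of the code times the
number of colliding pairs, and Markov's inequality bounds that number through its expectation.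
If `D` bounds the effect of the tolerance `ε` on the exponents, then `η(ε) = -4 D ε` leaves a
margin of `D ε` in both cases.
-/

noncomputable section

namespace QGC

section Entropy

variable {S α β γ 𝒬 : Type*}

lemma toReal_pos_of_ne_zero {P : PMF α} {a : α} (ha : P a ≠ 0) : 0 < (P a).toReal :=
  ENNReal.toReal_pos ha (P.apply_ne_top a)

lemma toReal_apply_le_one (P : PMF α) (a : α) : (P a).toReal ≤ 1 :=
  ENNReal.toReal_le_of_le_ofReal zero_le_one (by simpa using P.coe_le_one a)

/-- The conditional probability of the outcome `t` given the value `g t` of the observation `g`;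
it is `0` if `P t = 0`. -/
def condProb (P : PMF S) (g : S → β) (t : S) : ℝ := (P t).toReal / (P.map g (g t)).toReal

lemma condProb_nonneg (P : PMF S) (g : S → β) (t : S) : 0 ≤ condProb P g t :=
  div_nonneg ENNReal.toReal_nonneg ENNReal.toReal_nonneg

lemma condProb_const (P : PMF S) (b : β) (t : S) : condProb P (fun _ => b) t = (P t).toReal := by
  simp [condProb, show P.map (fun _ => b) = PMF.pure b from P.map_const b]

lemma toReal_apply_le_toReal_map (P : PMF S) (g : S → β) (t : S) :
    (P t).toReal ≤ (P.map g (g t)).toReal := by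
  classical
  refine ENNReal.toReal_mono (PMF.apply_ne_top _ _) ?_
  rw [PMF.map_apply]
  exact (if_pos rfl).symm.trans_le (ENNReal.le_tsum (f := fun a => if g t = g a then P a else 0) t)

lemma toReal_map_apply_of_injective (P : PMF S) {h : S → α} (hh : h.Injective) (t : S) :
    (P.map h (h t)).toReal = (P t).toReal := by
  classical
  rw [PMF.map_apply, tsum_eq_single t fun a ha => if_neg (hh.ne ha.symm), if_pos rfl]

lemma condProb_le_one (P : PMF S) (g : S → β) (t : S) : condProb P g t ≤ 1 :=
  div_le_one_of_le₀ (toReal_apply_le_toReal_map P g t) ENNReal.toReal_nonneg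

lemma toReal_apply_le_condProb (P : PMF S) (g : S → β) (t : S) :
    (P t).toReal ≤ condProb P g t := by
  by_cases ht : P t = 0
  · simpa [ht] using condProb_nonneg P g t
  · exact le_div_self ENNReal.toReal_nonneg
      ((toReal_pos_of_ne_zero ht).trans_le (toReal_apply_le_toReal_map P g t))
      (toReal_apply_le_one _ _)

lemma condProb_pos {P : PMF S} (g : S → β) {t : S} (ht : P t ≠ 0) : 0 < condProb P g t :=
  (toReal_pos_of_ne_zero ht).trans_le (toReal_apply_le_condProb P g t)

lemma toReal_mul_logb_condProb_nonpos (P : PMF S) (g : S → β) (t : S) :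
    (P t).toReal * Real.logb 2 (condProb P g t) ≤ 0 :=
  mul_nonpos_of_nonneg_of_nonpos ENNReal.toReal_nonneg
    (Real.logb_nonpos one_lt_two (condProb_nonneg P g t) (condProb_le_one P g t))

lemma pairLaw_apply (P : PMF 𝒬) (K : 𝒬 → PMF α) (q : 𝒬) (a : α) :
    pairLaw P K (q, a) = P q * K q a := by
  classical
  rw [pairLaw, PMF.bind_apply, tsum_eq_single q fun q' hq' => by simp [PMF.map_apply, hq'.symm],
    PMF.map_apply, tsum_eq_single a fun a' ha' => by simp [ha'.symm], if_pos rfl]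

lemma condProb_pairLaw {P : PMF 𝒬} {K : 𝒬 → PMF α} {g : 𝒬 × α → β}
    {g' : α → γ} (hg : ∀ q a q' a', g (q, a) = g (q', a') ↔ q = q' ∧ g' a = g' a')
    {q : 𝒬} (hq : P q ≠ 0) (a : α) :
    condProb (pairLaw P K) g (q, a) = condProb (K q) g' a := by
  classical
  have hmass : (pairLaw P K).map g (g (q, a)) = P q * (K q).map g' (g' a) := by
    rw [pairLaw, PMF.map_bind, PMF.bind_apply, tsum_eq_single q fun q' hq' => by
      simp [PMF.map_comp, PMF.map_apply, hg, hq'.symm]]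
    simp [PMF.map_comp, PMF.map_apply, hg]
  rw [condProb, hmass, pairLaw_apply, ENNReal.toReal_mul, ENNReal.toReal_mul, condProb,
    mul_div_mul_left _ _ (toReal_pos_of_ne_zero hq).ne']

variable [Fintype S]

lemma sum_toReal (P : PMF S) : ∑ t, (P t).toReal = 1 := by
  rw [← ENNReal.toReal_sum fun t _ => P.apply_ne_top t, ← tsum_fintype (L := .unconditional S),
    P.tsum_coe, ENNReal.toReal_one]

open Classical in
lemma toReal_map_apply (P : PMF S) (h : S → α) (b : α) :
    (P.map h b).toReal = ∑ t with h t = b, (P t).toReal := by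
  rw [PMF.map_apply, tsum_fintype, ENNReal.toReal_sum, Finset.sum_filter]
  · refine Finset.sum_congr rfl fun t _ => ?_
    simp only [eq_comm (a := b), apply_ite ENNReal.toReal, ENNReal.toReal_zero]
  · intro t _
    split_ifs
    · exact P.apply_ne_top t
    · exact ENNReal.zero_ne_top

lemma sum_toReal_map_mul [Fintype α] (P : PMF S) (h : S → α) (F : α → ℝ) :
    ∑ b, (P.map h b).toReal * F b = ∑ t, (P t).toReal * F (h t) := by
  classical
  rw [← Finset.sum_fiberwise Finset.univ h]
  refine Finset.sum_congr rfl fun b _ => ?_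
  rw [toReal_map_apply, Finset.sum_mul]
  exact Finset.sum_congr (by congr!) fun t ht => by rw [(Finset.mem_filter.1 ht).2]

open Classical in
lemma sum_condProb_fiber_le_one (P : PMF S) (g : S → β) (b : β) :
    ∑ t with g t = b, condProb P g t ≤ 1 := by
  have hsum : ∑ t with g t = b, condProb P g t = (P.map g b).toReal / (P.map g b).toReal := by
    conv_rhs => rw [toReal_map_apply, Finset.sum_div, ← toReal_map_apply]
    exact Finset.sum_congr rfl fun t ht => by rw [condProb, (Finset.mem_filter.1 ht).2]
  exact hsum.trans_le (div_self_le_one _)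

lemma condEntropy_eq_neg_sum [Fintype α] [Fintype β] (P : PMF S) {f : S → α} {g : S → β}
    (hfg : Function.Injective fun t => (f t, g t)) :
    condEntropy P f g = -∑ t, (P t).toReal * Real.logb 2 (condProb P g t) := by
  rw [condEntropy, ← Fintype.sum_prod_type' (f := fun a b =>
    (P.map (fun t => (f t, g t)) (a, b)).toReal *
      Real.logb 2 ((P.map (fun t => (f t, g t)) (a, b)).toReal / (P.map g b).toReal)),
    sum_toReal_map_mul P (fun t => (f t, g t)) fun z =>
      Real.logb 2 ((P.map (fun t => (f t, g t)) (z.1, z.2)).toReal / (P.map g z.2).toReal)]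
  simp only [toReal_map_apply_of_injective P hfg, condProb]

lemma condEntropy_id_eq_neg_sum [Fintype β] (P : PMF S) (g : S → β) :
    condEntropy P id g = -∑ t, (P t).toReal * Real.logb 2 (condProb P g t) :=
  condEntropy_eq_neg_sum P fun _ _ h => (Prod.mk.inj h).1

lemma condEntropy_eq_condEntropy_id [Fintype α] [Fintype β] (P : PMF S) {f : S → α} {g : S → β}
    (hfg : Function.Injective fun t => (f t, g t)) : condEntropy P f g = condEntropy P id g := by
  rw [condEntropy_eq_neg_sum P hfg, condEntropy_id_eq_neg_sum]

lemma condEntropy_id_nonneg [Fintype β] (P : PMF S) (g : S → β) : 0 ≤ condEntropy P id g := by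
  rw [condEntropy_id_eq_neg_sum, Left.nonneg_neg_iff]
  exact Finset.sum_nonpos fun t _ => toReal_mul_logb_condProb_nonpos P g t

lemma condEntropy_id_le_const [Fintype β] (P : PMF S) (g : S → β) :
    condEntropy P id g ≤ condEntropy P id fun _ => () := by
  rw [condEntropy_id_eq_neg_sum, condEntropy_id_eq_neg_sum, neg_le_neg_iff]
  refine Finset.sum_le_sum fun t _ => ?_
  by_cases ht : P t = 0
  · simp [ht]
  refine mul_le_mul_of_nonneg_left ?_ ENNReal.toReal_nonneg
  rw [condProb_const]
  exact Real.logb_le_logb_of_le one_lt_two (toReal_pos_of_ne_zero ht)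
    (toReal_apply_le_condProb P g t)

lemma injOn_support_of_condEntropy_id_eq_zero [Fintype β] {P : PMF S} {g : S → β}
    (h : condEntropy P id g = 0) : Set.InjOn g P.support := by
  classical
  intro t ht t' ht' htt'
  by_contra hne
  have hlt : condProb P g t < 1 := by
    calc condProb P g t < condProb P g t + condProb P g t' :=
          lt_add_of_pos_right _ (condProb_pos g ht')
      _ = ∑ s ∈ {t, t'}, condProb P g s := (Finset.sum_pair hne).symm
      _ ≤ ∑ s with g s = g t, condProb P g s :=
          Finset.sum_le_sum_of_subset_of_nonneg (by simp [Finset.insert_subset_iff, htt'])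
            fun s _ _ => condProb_nonneg P g s
      _ ≤ 1 := sum_condProb_fiber_le_one P g (g t)
  rw [condEntropy_id_eq_neg_sum, neg_eq_zero, Finset.sum_eq_zero_iff_of_nonpos fun s _ =>
    toReal_mul_logb_condProb_nonpos P g s] at h
  exact (mul_neg_of_pos_of_neg (toReal_pos_of_ne_zero ht)
    (Real.logb_neg one_lt_two (condProb_pos g ht) hlt)).ne (h t (Finset.mem_univ t))

lemma condEntropy_id_pairLaw [Fintype 𝒬] [Fintype α] [Fintype β] [Fintype γ] (P : PMF 𝒬)
    (K : 𝒬 → PMF α) {g : 𝒬 × α → β} {g' : α → γ}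
    (hg : ∀ q a q' a', g (q, a) = g (q', a') ↔ q = q' ∧ g' a = g' a') :
    condEntropy (pairLaw P K) id g = ∑ q, (P q).toReal * condEntropy (K q) id g' := by
  simp only [condEntropy_id_eq_neg_sum, Fintype.sum_prod_type, ← Finset.sum_neg_distrib,
    Finset.mul_sum, pairLaw_apply, ENNReal.toReal_mul]
  refine Finset.sum_congr rfl fun q _ => Finset.sum_congr rfl fun a _ => ?_
  by_cases hq : P q = 0
  · simp [hq]
  · rw [condProb_pairLaw hg hq, mul_assoc, mul_neg]

end Entropy

section TypicalSequences

open MeasureTheory ProbabilityTheory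

variable {α β : Type*} {n : ℕ}

lemma sum_comp_eq_sum_occ_mul [Fintype α] (x : Fin n → α) (f : α → ℝ) :
    ∑ i, f (x i) = ∑ a, (occ a x : ℝ) * f a := by
  classical
  rw [← Finset.sum_fiberwise Finset.univ x]
  refine Finset.sum_congr rfl fun a _ => ?_
  rw [Finset.sum_congr rfl fun i hi => by rw [(Finset.mem_filter.1 hi).2], Finset.sum_const,
    nsmul_eq_mul, occ]

lemma occ_eq_zero_iff {a : α} {x : Fin n → α} : occ a x = 0 ↔ ∀ i, x i ≠ a := by
  simp [occ, Finset.filter_eq_empty_iff]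

lemma occ_eq_sum_indicator (a : α) (x : Fin n → α) :
    (occ a x : ℝ) = ∑ i, Set.indicator {a} 1 (x i) := by
  classical
  simp [occ, Set.indicator_apply]

lemma measureReal_pi_toMeasure_finset [MeasurableSpace α] [MeasurableSingletonClass α]
    (P : PMF α) (s : Finset (Fin n → α)) :
    (Measure.pi fun _ : Fin n => P.toMeasure).real s = ∑ x ∈ s, ∏ i, (P (x i)).toReal := by
  rw [← sum_measureReal_singleton]
  refine Finset.sum_congr rfl fun x _ => ?_
  simp only [Measure.real, Measure.pi_singleton, ENNReal.toReal_prod,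
    PMF.toMeasure_apply_singleton P _ (measurableSet_singleton _)]

lemma abs_logb_condProb_le (P : PMF α) (g : α → β) (a : α) :
    |Real.logb 2 (condProb P g a)| ≤ |Real.logb 2 (P a).toReal| := by
  by_cases ha : P a = 0
  · simp [condProb, ha]
  rw [abs_of_nonpos (Real.logb_nonpos one_lt_two (condProb_nonneg P g a) (condProb_le_one P g a)),
    abs_of_nonpos (Real.logb_nonpos one_lt_two ENNReal.toReal_nonneg (toReal_apply_le_one P a)),
    neg_le_neg_iff]
  exact Real.logb_le_logb_of_le one_lt_two (toReal_pos_of_ne_zero ha)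
    (toReal_apply_le_condProb P g a)

section Chebyshev

variable [Finite α] [MeasurableSpace α] [MeasurableSingletonClass α]

lemma integral_occ_pi (P : PMF α) (a : α) (n : ℕ) :
    ∫ x, (occ a x : ℝ) ∂Measure.pi (fun _ : Fin n => P.toMeasure) = n * (P a).toReal := by
  simp only [occ_eq_sum_indicator]
  rw [integral_finsetSum _ fun i _ => Integrable.of_finite]
  have hterm (i : Fin n) : ∫ x : Fin n → α, Set.indicator {a} 1 (x i)
      ∂Measure.pi (fun _ : Fin n => P.toMeasure) = (P a).toReal := by
    rw [integral_comp_eval (μ := fun _ : Fin n => P.toMeasure) (f := Set.indicator {a} 1)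
      Measurable.of_discrete.aestronglyMeasurable, integral_indicator_one .of_discrete,
      Measure.real, PMF.toMeasure_apply_singleton P a (measurableSet_singleton a)]
  simp only [hterm, Finset.sum_const, Finset.card_univ, Fintype.card_fin, nsmul_eq_mul]

lemma variance_occ_pi_le (P : PMF α) (a : α) (n : ℕ) :
    Var[fun x => (occ a x : ℝ); Measure.pi fun _ : Fin n => P.toMeasure] ≤ n / 4 := by
  set f : α → ℝ := Set.indicator {a} 1
  have hsum : (fun x : Fin n → α => (occ a x : ℝ)) = ∑ i, fun x => f (x i) := by
    ext x
    rw [occ_eq_sum_indicator, Finset.sum_apply]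
  have hindep : iIndepFun (fun i (x : Fin n → α) => f (x i))
      (Measure.pi fun _ : Fin n => P.toMeasure) :=
    iIndepFun_pi fun _ => (Measurable.of_discrete (f := f)).aemeasurable
  rw [hsum, IndepFun.variance_sum (fun i _ => MemLp.of_discrete)
    fun i _ j _ hij => hindep.indepFun hij]
  have hterm (i : Fin n) : Var[fun x : Fin n → α => f (x i);
      Measure.pi fun _ : Fin n => P.toMeasure] ≤ 1 / 4 := by
    rw [(measurePreserving_eval (fun _ : Fin n => P.toMeasure) i).variance_fun_comp
      Measurable.of_discrete.aemeasurable]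
    refine (variance_le_sq_of_bounded (a := 0) (b := 1) (ae_of_all _ fun b => ?_)
      Measurable.of_discrete.aemeasurable).trans_eq (by norm_num)
    by_cases hb : b ∈ ({a} : Set α) <;> simp [f, hb]
  calc _ ≤ ∑ _i : Fin n, (1 / 4 : ℝ) := Finset.sum_le_sum fun i _ => hterm i
    _ = n / 4 := by simp [div_eq_mul_inv]

lemma measureReal_le_abs_occ_sub_le (P : PMF α) (a : α) (hn : n ≠ 0) {τ : ℝ} (hτ : 0 < τ) :
    (Measure.pi fun _ : Fin n => P.toMeasure).real
      {x | τ ≤ |(occ a x : ℝ) / n - (P a).toReal|} ≤ 1 / (4 * n * τ ^ 2) := by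
  have hn' : (0 : ℝ) < n := Nat.cast_pos.2 (Nat.pos_of_ne_zero hn)
  have hset : {x : Fin n → α | τ ≤ |(occ a x : ℝ) / n - (P a).toReal|} =
      {x | n * τ ≤ |(occ a x : ℝ) -
        ∫ x, (occ a x : ℝ) ∂Measure.pi (fun _ : Fin n => P.toMeasure)|} := by
    ext x
    rw [Set.mem_ofPred_eq, Set.mem_ofPred_eq, integral_occ_pi, ← mul_le_mul_iff_right₀ hn',
      ← abs_of_pos hn', ← abs_mul, abs_of_pos hn', mul_sub, mul_div_cancel₀ _ hn'.ne']
  have hvar : Var[fun x => (occ a x : ℝ); Measure.pi fun _ : Fin n => P.toMeasure] / (n * τ) ^ 2 ≤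
      1 / (4 * n * τ ^ 2) := by
    refine (div_le_div_of_nonneg_right (variance_occ_pi_le P a n) (by positivity)).trans_eq ?_
    field_simp
  rw [hset]
  exact ENNReal.toReal_le_of_le_ofReal (by positivity) ((meas_ge_le_variance_div_sq
    MemLp.of_discrete (mul_pos hn' hτ)).trans (ENNReal.ofReal_le_ofReal hvar))

lemma ae_pi_apply_ne_zero (P : PMF α) (n : ℕ) :
    ∀ᵐ x ∂Measure.pi (fun _ : Fin n => P.toMeasure), ∀ i, P (x i) ≠ 0 := by
  refine ae_all_iff.2 fun i => ?_
  have hP : ∀ᵐ a ∂P.toMeasure, P a ≠ 0 := by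
    rw [ae_iff, PMF.toMeasure_apply_eq_zero_iff P .of_discrete]
    simp [Set.disjoint_left]
  exact (measurePreserving_eval (fun _ : Fin n => P.toMeasure) i).quasiMeasurePreserving.ae hP

end Chebyshev

variable [Fintype α] {P : PMF α} {ε : ℝ} {x : Fin n → α}

lemma apply_ne_zero_of_mem_typicalSet (hx : x ∈ typicalSet P ε n) (i : Fin n) : P (x i) ≠ 0 :=
  fun h => occ_eq_zero_iff.1 ((hx (x i)).2 h) i rfl

/-- The mean of `|log₂ P(a)|` over all letters `a`: the factor by which the tolerance `ε` in
the definition of typicality enters into the exponents of the probabilities of typical sequences. -/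
def logDev (P : PMF α) : ℝ := (∑ a, |Real.logb 2 (P a).toReal|) / Fintype.card α

lemma logDev_nonneg (P : PMF α) : 0 ≤ logDev P :=
  div_nonneg (Finset.sum_nonneg fun _ _ => abs_nonneg _) (Nat.cast_nonneg _)

lemma abs_sum_logb_condProb_add_le [Fintype β] (g : α → β) (hx : x ∈ typicalSet P ε n) :
    |∑ i, Real.logb 2 (condProb P g (x i)) + n * condEntropy P id g| ≤ n * (ε * logDev P) := by
  rcases n.eq_zero_or_pos with rfl | hn
  · simp
  have hn' : (0 : ℝ) < n := Nat.cast_pos.2 hn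
  have hsum : ∑ i, Real.logb 2 (condProb P g (x i)) + n * condEntropy P id g =
      n * ∑ a, ((occ a x : ℝ) / n - (P a).toReal) * Real.logb 2 (condProb P g a) := by
    rw [sum_comp_eq_sum_occ_mul x fun a => Real.logb 2 (condProb P g a),
      condEntropy_id_eq_neg_sum, mul_neg, ← sub_eq_add_neg, Finset.mul_sum, Finset.mul_sum,
      ← Finset.sum_sub_distrib]
    refine Finset.sum_congr rfl fun a _ => ?_
    field_simp
  rw [hsum, abs_mul, abs_of_pos hn', logDev, mul_div_left_comm, mul_comm (∑ a, _), Finset.mul_sum]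
  gcongr
  refine (Finset.abs_sum_le_sum_abs _ _).trans (Finset.sum_le_sum fun a _ => ?_)
  rw [abs_mul]
  exact mul_le_mul (hx a).1 (abs_logb_condProb_le P g a) (abs_nonneg _)
    ((abs_nonneg _).trans (hx a).1)

lemma prod_condProb_eq_rpow (g : α → β) (hx : x ∈ typicalSet P ε n) :
    ∏ i, condProb P g (x i) = (2 : ℝ) ^ ∑ i, Real.logb 2 (condProb P g (x i)) := by
  rw [Real.rpow_sum_of_pos two_pos]
  exact Finset.prod_congr rfl fun i _ => (Real.rpow_logb two_pos one_lt_two.ne'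
    (condProb_pos g (apply_ne_zero_of_mem_typicalSet hx i))).symm

lemma rpow_le_prod_condProb [Fintype β] (g : α → β) (hx : x ∈ typicalSet P ε n) :
    (2 : ℝ) ^ (-(n * (condEntropy P id g + ε * logDev P))) ≤ ∏ i, condProb P g (x i) := by
  rw [prod_condProb_eq_rpow g hx]
  refine Real.rpow_le_rpow_of_exponent_le one_le_two ?_
  linarith [(abs_le.1 (abs_sum_logb_condProb_add_le g hx)).1]

lemma prod_apply_le_rpow (hx : x ∈ typicalSet P ε n) :
    ∏ i, (P (x i)).toReal ≤ (2 : ℝ) ^ (-(n * (condEntropy P id (fun _ => ()) - ε * logDev P))) := by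
  simp only [← condProb_const P ()]
  rw [prod_condProb_eq_rpow _ hx]
  refine Real.rpow_le_rpow_of_exponent_le one_le_two ?_
  linarith [(abs_le.1 (abs_sum_logb_condProb_add_le (fun _ => ()) hx)).2]

lemma ncard_typicalSet_fiber_le [Fintype β] (P : PMF α) (g : α → β) (ε : ℝ) (v : Fin n → β) :
    ({x ∈ typicalSet P ε n | ∀ i, g (x i) = v i}.ncard : ℝ) ≤
      (2 : ℝ) ^ (n * (condEntropy P id g + ε * logDev P)) := by
  classical
  set E := n * (condEntropy P id g + ε * logDev P)
  have hmass : ({x ∈ typicalSet P ε n | ∀ i, g (x i) = v i}.ncard : ℝ) * (2 : ℝ) ^ (-E) ≤ 1 := by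
    calc _ ≤ ∑ x with x ∈ typicalSet P ε n ∧ ∀ i, g (x i) = v i, ∏ i, condProb P g (x i) := by
          rw [Set.ncard_eq_toFinset_card', Set.toFinset_ofPred, ← nsmul_eq_mul]
          exact Finset.card_nsmul_le_sum _ _ _ fun x hx =>
            rpow_le_prod_condProb g (Finset.mem_filter.1 hx).2.1
      _ ≤ ∑ x ∈ Fintype.piFinset fun i => Finset.univ.filter fun a => g a = v i,
            ∏ i, condProb P g (x i) :=
          Finset.sum_le_sum_of_subset_of_nonneg
            (fun x hx => by simpa [Fintype.mem_piFinset] using (Finset.mem_filter.1 hx).2.2)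
            fun _ _ _ => Finset.prod_nonneg fun _ _ => condProb_nonneg _ _ _
      _ = ∏ i, ∑ a with g a = v i, condProb P g a := (Finset.prod_univ_sum _ _).symm
      _ ≤ 1 := Finset.prod_le_one
          (fun _ _ => Finset.sum_nonneg fun _ _ => condProb_nonneg _ _ _)
          fun i _ => sum_condProb_fiber_le_one P g (v i)
  rwa [Real.rpow_neg two_pos.le, ← div_eq_mul_inv, div_le_one (by positivity)] at hmass

lemma measureReal_compl_typicalSet_le [MeasurableSpace α] [MeasurableSingletonClass α]
    (P : PMF α) (hε : 0 < ε) (hn : n ≠ 0) :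
    (Measure.pi fun _ : Fin n => P.toMeasure).real (typicalSet P ε n)ᶜ ≤
      Fintype.card α ^ 3 / (4 * n * ε ^ 2) := by
  have : Nonempty α := P.support_nonempty.to_type
  have : (0 : ℝ) < Fintype.card α := Nat.cast_pos.2 Fintype.card_pos
  set μ := Measure.pi fun _ : Fin n => P.toMeasure
  have hsub : (typicalSet P ε n)ᶜ ≤ᵐ[μ]
      ⋃ a, {x | ε / Fintype.card α ≤ |(occ a x : ℝ) / n - (P a).toReal|} := by
    filter_upwards [ae_pi_apply_ne_zero P n] with x hx
    intro (hxt : x ∉ typicalSet P ε n)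
    by_contra hno
    have hlt (a : α) : |(occ a x : ℝ) / n - (P a).toReal| < ε / Fintype.card α :=
      not_le.1 fun h => hno (Set.mem_iUnion.2 ⟨a, h⟩)
    exact hxt fun a => ⟨(hlt a).le, fun ha => occ_eq_zero_iff.2 fun i hi => hx i (hi ▸ ha)⟩
  calc μ.real (typicalSet P ε n)ᶜ
      ≤ μ.real (⋃ a, {x | ε / Fintype.card α ≤ |(occ a x : ℝ) / n - (P a).toReal|}) :=
        ENNReal.toReal_mono (measure_ne_top _ _) (measure_mono_ae hsub)
    _ ≤ ∑ a, μ.real {x | ε / Fintype.card α ≤ |(occ a x : ℝ) / n - (P a).toReal|} :=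
        measureReal_iUnion_fintype_le _
    _ ≤ ∑ _a : α, 1 / (4 * n * (ε / Fintype.card α) ^ 2) :=
        Finset.sum_le_sum fun a _ => measureReal_le_abs_occ_sub_le P a hn (by positivity)
    _ = Fintype.card α ^ 3 / (4 * n * ε ^ 2) := by
        rw [Finset.sum_const, Finset.card_univ, nsmul_eq_mul]
        field_simp

lemma half_mul_rpow_le_ncard_typicalSet (P : PMF α) (hε : 0 < ε)
    (hlong : (Fintype.card α : ℝ) ^ 3 / (2 * ε ^ 2) ≤ n) :
    1 / 2 * (2 : ℝ) ^ (n * (condEntropy P id (fun _ => ()) - ε * logDev P)) ≤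
      (typicalSet P ε n).ncard := by
  classical
  let _ : MeasurableSpace α := ⊤
  have : Nonempty α := P.support_nonempty.to_type
  have hn : (0 : ℝ) < n := hlong.trans_lt' (by positivity)
  set E := n * (condEntropy P id (fun _ => ()) - ε * logDev P)
  set μ := Measure.pi fun _ : Fin n => P.toMeasure
  have hmass : 1 / 2 ≤ ((typicalSet P ε n).ncard : ℝ) * (2 : ℝ) ^ (-E) := by
    calc (1 / 2 : ℝ) ≤ 1 - Fintype.card α ^ 3 / (4 * n * ε ^ 2) := by
          rw [div_le_iff₀ (by positivity)] at hlong
          rw [le_sub_comm, div_le_iff₀ (by positivity)]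
          linarith
      _ ≤ 1 - μ.real (typicalSet P ε n)ᶜ := by
          gcongr
          exact measureReal_compl_typicalSet_le P hε (Nat.cast_ne_zero.1 hn.ne')
      _ = ∑ x ∈ (typicalSet P ε n).toFinset, ∏ i, (P (x i)).toReal := by
          rw [probReal_compl_eq_one_sub .of_discrete, sub_sub_cancel,
            ← measureReal_pi_toMeasure_finset, Set.coe_toFinset]
      _ ≤ ((typicalSet P ε n).ncard : ℝ) * (2 : ℝ) ^ (-E) := by
          rw [Set.ncard_eq_toFinset_card', ← nsmul_eq_mul]
          exact Finset.sum_le_card_nsmul _ _ _ fun x hx =>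
            prod_apply_le_rpow (Set.mem_toFinset.1 hx)
  rwa [Real.rpow_neg two_pos.le, ← div_eq_mul_inv, le_div_iff₀ (by positivity)] at hmass

end TypicalSequences

section IndexSet

variable {𝒬 α β : Type*} {p r : ℕ} [Fact p.Prime]

lemma ncard_setOf_forall_block_mem [Fintype 𝒬] {κ : 𝒬 → Type*} (S : ∀ q, Set (κ q → α)) :
    {u : (Σ q, κ q) → α | ∀ q, (fun i => u ⟨q, i⟩) ∈ S q}.ncard = ∏ q, (S q).ncard := by
  have hpre : {u : (Σ q, κ q) → α | ∀ q, (fun i => u ⟨q, i⟩) ∈ S q} =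
      Equiv.piCurry (fun _ _ => α) ⁻¹' Set.univ.pi S := by
    ext u
    exact ⟨fun hu q _ => hu q, fun hu q => hu q trivial⟩
  rw [hpre, Set.ncard_def, Set.encard_preimage_of_bijective (Equiv.bijective _),
    Set.encard_pi_eq_prod_encard]
  exact map_prod ENat.toNatHom _ _

lemma ncard_indexSet_fiber_le [Fintype 𝒬] [Fintype β] (PU : 𝒬 → PMF (ZMod (p ^ r)))
    (g : ZMod (p ^ r) → β) (ε : ℝ) {k : 𝒬 → ℕ} (v : (Σ q, Fin (k q)) → β) :
    ({u ∈ indexSet PU ε k | ∀ j, g (u j) = v j}.ncard : ℝ) ≤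
      (2 : ℝ) ^ ∑ q, k q * (condEntropy (PU q) id g + ε * logDev (PU q)) := by
  have hset : {u ∈ indexSet PU ε k | ∀ j, g (u j) = v j} = {u | ∀ q, (fun i => u ⟨q, i⟩) ∈
      {x ∈ typicalSet (PU q) ε (k q) | ∀ i, g (x i) = v ⟨q, i⟩}} := by
    ext u
    exact ⟨fun hu q => ⟨hu.1 q, fun i => hu.2 ⟨q, i⟩⟩, fun hu => ⟨fun q => (hu q).1,
      fun j => (hu j.1).2 j.2⟩⟩
  rw [hset, ncard_setOf_forall_block_mem, Nat.cast_prod, Real.rpow_sum_of_pos two_pos]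
  exact Finset.prod_le_prod (fun _ _ => Nat.cast_nonneg _)
    fun q _ => ncard_typicalSet_fiber_le (PU q) g ε fun i => v ⟨q, i⟩

lemma rpow_le_ncard_indexSet [Fintype 𝒬] (PU : 𝒬 → PMF (ZMod (p ^ r))) {ε : ℝ} (hε : 0 < ε)
    {k : 𝒬 → ℕ} (hlong : ∀ q, ((p : ℝ) ^ r) ^ 3 / (2 * ε ^ 2) ≤ k q) :
    (2 : ℝ) ^ ∑ q, (k q * (condEntropy (PU q) id (fun _ => ()) - ε * logDev (PU q)) - 1) ≤
      (indexSet PU ε k).ncard := by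
  rw [indexSet, ncard_setOf_forall_block_mem, Nat.cast_prod, Real.rpow_sum_of_pos two_pos]
  refine Finset.prod_le_prod (fun _ _ => by positivity) fun q _ => ?_
  rw [Real.rpow_sub_one two_ne_zero, div_eq_inv_mul, ← one_div]
  exact half_mul_rpow_le_ncard_typicalSet (PU q) hε (by simpa [ZMod.card] using hlong q)

lemma injOn_indexSet_of_condEntropy_eq_zero [Fintype β] {PU : 𝒬 → PMF (ZMod (p ^ r))}
    {g : ZMod (p ^ r) → β} (h0 : ∀ q, condEntropy (PU q) id g = 0) (ε : ℝ) (k : 𝒬 → ℕ) :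
    Set.InjOn (g ∘ ·) (indexSet PU ε k) := by
  intro u hu v hv huv
  funext ⟨q, i⟩
  exact injOn_support_of_condEntropy_id_eq_zero (h0 q) (apply_ne_zero_of_mem_typicalSet (hu q) i)
    (apply_ne_zero_of_mem_typicalSet (hv q) i) (congrFun huv ⟨q, i⟩)

end IndexSet

section Levels

variable {p r : ℕ} {ι : Type*}

lemma exists_lt_emultiplicity_sub_eq {u v : ι → ZMod (p ^ r)} (huv : u ≠ v) :
    ∃ s < r, emultiplicity (p : ι → ZMod (p ^ r)) (u - v) = s := by
  have hlt : emultiplicity (p : ι → ZMod (p ^ r)) (u - v) < r := by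
    have hzero : ((p ^ r : ℕ) : ι → ZMod (p ^ r)) = 0 := by
      ext
      simp
    rwa [emultiplicity_lt_iff_not_dvd, ← Nat.cast_pow, hzero, zero_dvd_iff, sub_eq_zero]
  obtain ⟨s, hs⟩ := ENat.ne_top_iff_exists.1 hlt.ne_top
  exact ⟨s, by exact_mod_cast hs ▸ hlt, hs.symm⟩

variable [Fact p.Prime]

lemma trunc_eq_trunc_iff {s : ℕ} (hs : s ≤ r) (a b : ZMod (p ^ r)) :
    trunc p r s a = trunc p r s b ↔ (p : ZMod (p ^ r)) ^ s ∣ a - b := by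
  have hlt (m : ℕ) : m % p ^ s < p ^ r :=
    (Nat.mod_lt _ (NeZero.pos _)).trans_le (Nat.pow_le_pow_right (Fact.out : p.Prime).pos hs)
  have hval : trunc p r s a = trunc p r s b ↔ a.val ≡ b.val [MOD p ^ s] := by
    rw [trunc, trunc, ZMod.natCast_eq_natCast_iff', Nat.mod_eq_of_lt (hlt _),
      Nat.mod_eq_of_lt (hlt _), Nat.ModEq]
  rw [hval]
  constructor
  · intro h
    obtain ⟨z, hz⟩ := Nat.modEq_iff_dvd.1 h.symm
    exact ⟨(z : ZMod (p ^ r)), by simpa using congrArg (Int.cast : ℤ → ZMod (p ^ r)) hz⟩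
  · rintro ⟨z, hz⟩
    have hmod := congrArg (ZMod.castHom (pow_dvd_pow p hs) (ZMod (p ^ s))) hz
    rw [map_mul, map_pow, map_natCast, ← Nat.cast_pow, ZMod.natCast_self, zero_mul, map_sub,
      sub_eq_zero] at hmod
    rw [← ZMod.natCast_eq_natCast_iff]
    simpa [ZMod.natCast_val] using hmod

lemma trunc_comp_eq_trunc_comp_iff {s : ℕ} (hs : s ≤ r) (u v : ι → ZMod (p ^ r)) :
    (trunc p r s ∘ u) = trunc p r s ∘ v ↔ (p : ι → ZMod (p ^ r)) ^ s ∣ u - v := by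
  simp [funext_iff, trunc_eq_trunc_iff hs, pi_dvd_iff]

lemma pow_sub_le_addOrderOf {s : ℕ} {a : ZMod (p ^ r)} (ha : ¬ (p : ZMod (p ^ r)) ^ (s + 1) ∣ a) :
    p ^ (r - s) ≤ addOrderOf a := by
  have hp : p.Prime := Fact.out
  obtain ⟨m, hm, hord⟩ := (Nat.dvd_prime_pow hp).1
    (show addOrderOf a ∣ p ^ r by simpa using addOrderOf_dvd_natCard a)
  have hdvd : p ^ m * p ^ (r - m) ∣ p ^ m * a.val := by
    rw [← pow_add, Nat.add_sub_cancel' hm, ← ZMod.natCast_eq_zero_iff, Nat.cast_mul,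
      ZMod.natCast_zmod_val, ← nsmul_eq_mul, ← hord, addOrderOf_nsmul_eq_zero]
  have hdvd' : (p : ZMod (p ^ r)) ^ (r - m) ∣ a := by
    simpa using Nat.cast_dvd_cast (α := ZMod (p ^ r))
      (Nat.dvd_of_mul_dvd_mul_left (pow_pos hp.pos m) hdvd)
  have hle : r - m ≤ s := not_lt.1 fun h => ha ((pow_dvd_pow _ h).trans hdvd')
  rw [hord]
  exact Nat.pow_le_pow_right hp.pos (by omega)

end Levels

section Counting

open Matrix

lemma ncard_setOf_vecMul_eq_mul_le {ι κ R : Type*} [Fintype ι] [Finite κ] [Ring R] [Finite R]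
    (w : ι → R) (j : ι) (d : κ → R) :
    {G : Matrix ι κ R | w ᵥ* G = d}.ncard * addOrderOf (w j) ^ Nat.card κ ≤
      Nat.card (Matrix ι κ R) := by
  classical
  have : Fintype κ := Fintype.ofFinite κ
  let row (t : κ → Fin (addOrderOf (w j))) : Matrix ι κ R :=
    vecMulVec (Pi.single j 1) fun l => (t l : ℕ)
  have hrow (t : κ → Fin (addOrderOf (w j))) (l : κ) : (w ᵥ* row t) l = (t l : ℕ) • w j := by
    simp [row, vecMul_vecMulVec, nsmul_eq_mul, Nat.cast_comm]
  have hinj : Function.Injective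
      fun z : {G : Matrix ι κ R | w ᵥ* G = d} × (κ → Fin (addOrderOf (w j))) =>
        (z.1 : Matrix ι κ R) + row z.2 := by
    rintro ⟨⟨G, hG⟩, t⟩ ⟨⟨G', hG'⟩, t'⟩ h
    have hw : w ᵥ* row t = w ᵥ* row t' := by
      have hmul := congrArg (w ᵥ* ·) h
      simp only [vecMul_add] at hmul
      rwa [hG, hG', add_right_inj] at hmul
    obtain rfl : t = t' := by
      funext l
      exact Fin.ext (nsmul_injOn_Iio_addOrderOf (t l).2 (t' l).2
        (by simpa only [hrow] using congrFun hw l))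
    simpa using h
  have hcard := Nat.card_le_card_of_injective _ hinj
  rwa [Nat.card_prod, Nat.card_fun, Nat.card_fin, Nat.card_coe_set_eq] at hcard

variable {p r n : ℕ} {𝒬 : Type*} [Fintype 𝒬] {k : 𝒬 → ℕ}

lemma codeword_sub_codeword (G : Matrix (Σ q, Fin (k q)) (Fin n) (ZMod (p ^ r)))
    (b : Fin n → ZMod (p ^ r)) (u v : (Σ q, Fin (k q)) → ZMod (p ^ r)) :
    codeword G b u - codeword G b v = (u - v) ᵥ* G := by
  rw [codeword, codeword, add_sub_add_right_eq_sub, sub_vecMul]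

lemma ncard_setOf_codeword_eq_and_mul_le [Fact p.Prime] {s : ℕ}
    {u v : (Σ q, Fin (k q)) → ZMod (p ^ r)}
    (huv : ¬ (p : (Σ q, Fin (k q)) → ZMod (p ^ r)) ^ (s + 1) ∣ u - v)
    (x y : Fin n → ZMod (p ^ r)) :
    {Z : Matrix (Σ q, Fin (k q)) (Fin n) (ZMod (p ^ r)) × (Fin n → ZMod (p ^ r)) |
        codeword Z.1 Z.2 u = x ∧ codeword Z.1 Z.2 v = y}.ncard * (p ^ (r - s)) ^ n ≤
      Nat.card (Matrix (Σ q, Fin (k q)) (Fin n) (ZMod (p ^ r))) := by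
  obtain ⟨j, hj⟩ : ∃ j, ¬ (p : ZMod (p ^ r)) ^ (s + 1) ∣ (u - v) j := by
    simpa [pi_dvd_iff] using huv
  refine (Nat.mul_le_mul ?_ (Nat.pow_le_pow_left (pow_sub_le_addOrderOf hj) n)).trans
    (by simpa using ncard_setOf_vecMul_eq_mul_le (u - v) j (x - y))
  refine Set.ncard_le_ncard_of_injOn Prod.fst ?_ ?_
  · rintro ⟨G, b⟩ ⟨rfl, rfl⟩
    exact (codeword_sub_codeword G b u v).symm
  · rintro ⟨G, b⟩ ⟨hx, -⟩ ⟨G', b'⟩ ⟨hx', -⟩ rfl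
    exact Prod.ext rfl (add_left_cancel (hx.trans hx'.symm))

end Counting

section Channel

open MeasureTheory

variable {Ω : Type*} [MeasurableSpace Ω] {μ : Measure Ω}

lemma sum_prod_toReal_eq_one {𝒳 𝒴 : Type*} [Fintype 𝒴] {n : ℕ} (W : 𝒳 → PMF 𝒴) (x : Fin n → 𝒳) :
    ∑ y : Fin n → 𝒴, ∏ i, (W (x i) (y i)).toReal = 1 := by
  classical
  rw [← Fintype.prod_sum fun i y => (W (x i) y).toReal]
  simp only [sum_toReal, Finset.prod_const_one]

lemma measureReal_biUnion_le_ncard_mul {α : Type*} {S : Set α} (hS : S.Finite) {E : α → Set Ω}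
    {κ : ℝ} (hE : ∀ a ∈ S, μ.real (E a) ≤ κ) : μ.real (⋃ a ∈ S, E a) ≤ S.ncard * κ := by
  lift S to Finset α using hS
  rw [Set.ncard_coe_finset, ← nsmul_eq_mul]
  exact (measureReal_biUnion_finset_le S E).trans (Finset.sum_le_card_nsmul _ _ _ hE)

lemma IsUniformRV.measurableSet_preimage {α : Type*} [Finite α] {Z : Ω → α}
    (hZ : IsUniformRV μ Z) (S : Set α) : MeasurableSet (Z ⁻¹' S) := by
  rw [← Set.biUnion_preimage_singleton]
  exact MeasurableSet.biUnion S.to_countable fun a _ => (hZ a).1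

variable [IsFiniteMeasure μ]

lemma IsUniformRV.measureReal_preimage {α : Type*} [Finite α] {Z : Ω → α}
    (hZ : IsUniformRV μ Z) (S : Set α) : μ.real (Z ⁻¹' S) = S.ncard / Nat.card α := by
  classical
  have : Fintype α := Fintype.ofFinite α
  rw [← Set.coe_toFinset S, ← sum_measureReal_preimage_singleton _ fun a _ => (hZ a).1,
    Finset.sum_congr rfl fun a _ => (hZ a).2, Set.ncard_coe_finset, Finset.sum_const,
    nsmul_eq_mul, mul_one_div]

variable {ι 𝒳 𝒴 : Type*} [Finite ι] [Finite 𝒳] {n : ℕ} {W : 𝒳 → PMF 𝒴} {𝒰 : Set ι}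
  {c : ι → Ω → Fin n → 𝒳} {u u₀ : ι} {Y : Ω → Fin n → 𝒴}

lemma IsChannelOutput.measureReal_eq_mul (hY : IsChannelOutput μ W 𝒰 c u₀ Y)
    (hc : ∀ v ∈ 𝒰, ∀ x, MeasurableSet (c v ⁻¹' {x})) (hu : u ∈ 𝒰) (hu₀ : u₀ ∈ 𝒰)
    (x x₀ : Fin n → 𝒳) (y : Fin n → 𝒴) :
    μ.real {ω | c u ω = x ∧ c u₀ ω = x₀ ∧ Y ω = y} =
      μ.real {ω | c u ω = x ∧ c u₀ ω = x₀} * ∏ i, (W (x₀ i) (y i)).toReal := by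
  classical
  have : Fintype (𝒰 → Fin n → 𝒳) := Fintype.ofFinite _
  let F (ω : Ω) (v : 𝒰) : Fin n → 𝒳 := c v ω
  let A : Finset (𝒰 → Fin n → 𝒳) := {f | f ⟨u, hu⟩ = x ∧ f ⟨u₀, hu₀⟩ = x₀}
  have hA : {ω | c u ω = x ∧ c u₀ ω = x₀} = F ⁻¹' A := by ext ω; simp [A, F]
  have hAy : {ω | c u ω = x ∧ c u₀ ω = x₀ ∧ Y ω = y} = F ⁻¹' A ∩ Y ⁻¹' {y} := by
    rw [← hA]
    ext ω
    exact and_assoc.symm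
  have hext (f : 𝒰 → Fin n → 𝒳) (v : 𝒰) :
      Function.extend Subtype.val f (fun _ => x) (v : ι) = f v :=
    Subtype.val_injective.extend_apply _ _ v
  have hF (f : 𝒰 → Fin n → 𝒳) :
      F ⁻¹' {f} = {ω | ∀ v ∈ 𝒰, c v ω = Function.extend Subtype.val f (fun _ => x) v} := by
    ext ω
    exact ⟨fun h v hv => (congrFun h ⟨v, hv⟩).trans (hext f ⟨v, hv⟩).symm,
      fun h => funext fun v => (h v v.2).trans (hext f v)⟩
  have hFmeas (f : 𝒰 → Fin n → 𝒳) : MeasurableSet (F ⁻¹' {f}) := by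
    have : F ⁻¹' {f} = ⋂ v : 𝒰, c v ⁻¹' {f v} := by ext ω; simp [F, funext_iff]
    exact this ▸ MeasurableSet.iInter fun v => hc v v.2 (f v)
  have hFy (f : 𝒰 → Fin n → 𝒳) (hf : f ∈ A) : (μ.restrict (Y ⁻¹' {y})).real (F ⁻¹' {f}) =
      μ.real (F ⁻¹' {f}) * ∏ i, (W (x₀ i) (y i)).toReal := by
    rw [measureReal_restrict_apply (hFmeas f), hF]
    refine (hY.2 _ y).trans ?_
    rw [hext f ⟨u₀, hu₀⟩, (Finset.mem_filter.1 hf).2.2]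
  rw [hAy, hA, ← measureReal_restrict_apply' (hY.1 y),
    ← sum_measureReal_preimage_singleton A fun f _ => hFmeas f,
    ← sum_measureReal_preimage_singleton A fun f _ => hFmeas f, Finset.sum_mul]
  exact Finset.sum_congr rfl hFy

lemma IsChannelOutput.measureReal_mem_le [Finite 𝒴] (hY : IsChannelOutput μ W 𝒰 c u₀ Y)
    (hc : ∀ v ∈ 𝒰, ∀ x, MeasurableSet (c v ⁻¹' {x})) (hu : u ∈ 𝒰) (hu₀ : u₀ ∈ 𝒰) {κ M : ℝ}
    (hκ : ∀ x x₀, μ.real {ω | c u ω = x ∧ c u₀ ω = x₀} ≤ κ)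
    {A : (Fin n → 𝒳) → (Fin n → 𝒴) → Set (Fin n → 𝒳)} (hA : ∀ x₀ y, ((A x₀ y).ncard : ℝ) ≤ M) :
    μ.real {ω | c u ω ∈ A (c u₀ ω) (Y ω)} ≤ Nat.card (Fin n → 𝒳) * (M * κ) := by
  classical
  have : Fintype (Fin n → 𝒳) := Fintype.ofFinite _
  have : Fintype 𝒴 := Fintype.ofFinite 𝒴
  have hcover : {ω | c u ω ∈ A (c u₀ ω) (Y ω)} ⊆ ⋃ x₀, ⋃ y, ⋃ x ∈ A x₀ y,
      {ω | c u ω = x ∧ c u₀ ω = x₀ ∧ Y ω = y} := fun ω hω => by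
    simpa using hω
  have hpoint (x₀ : Fin n → 𝒳) (y : Fin n → 𝒴) :
      μ.real (⋃ x ∈ A x₀ y, {ω | c u ω = x ∧ c u₀ ω = x₀ ∧ Y ω = y}) ≤
        M * κ * ∏ i, (W (x₀ i) (y i)).toReal := by
    have hW : 0 ≤ ∏ i, (W (x₀ i) (y i)).toReal :=
      Finset.prod_nonneg fun _ _ => ENNReal.toReal_nonneg
    have hκ0 : 0 ≤ κ := measureReal_nonneg.trans (hκ x₀ x₀)
    refine (measureReal_biUnion_le_ncard_mul (Set.toFinite _) fun x _ =>
      (hY.measureReal_eq_mul hc hu hu₀ x x₀ y).trans_le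
        (mul_le_mul_of_nonneg_right (hκ x x₀) hW)).trans ?_
    rw [mul_assoc]
    exact mul_le_mul_of_nonneg_right (hA x₀ y) (mul_nonneg hκ0 hW)
  calc μ.real {ω | c u ω ∈ A (c u₀ ω) (Y ω)}
      ≤ ∑ x₀, ∑ y, μ.real (⋃ x ∈ A x₀ y, {ω | c u ω = x ∧ c u₀ ω = x₀ ∧ Y ω = y}) :=
        (measureReal_mono hcover).trans <| (measureReal_iUnion_fintype_le _).trans <|
          Finset.sum_le_sum fun x₀ _ => measureReal_iUnion_fintype_le _
    _ ≤ ∑ x₀, ∑ y, M * κ * ∏ i, (W (x₀ i) (y i)).toReal :=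
        Finset.sum_le_sum fun x₀ _ => Finset.sum_le_sum fun y _ => hpoint x₀ y
    _ = Nat.card (Fin n → 𝒳) * (M * κ) := by
        simp only [← Finset.mul_sum, sum_prod_toReal_eq_one, mul_one, Finset.sum_const,
          Finset.card_univ, nsmul_eq_mul, Nat.card_eq_fintype_card]
        ring

end Channel

section RandomCodewords

open MeasureTheory

variable {Ω : Type*} [MeasurableSpace Ω] {μ : Measure Ω} {p r n : ℕ}
  [Fact p.Prime] {𝒬 : Type*} [Fintype 𝒬] {k : 𝒬 → ℕ}
  {G : Ω → Matrix (Σ q, Fin (k q)) (Fin n) (ZMod (p ^ r))} {B : Ω → Fin n → ZMod (p ^ r)}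

lemma measurableSet_setOf_codeword (hGB : IsUniformRV μ fun ω => (G ω, B ω))
    (S : Set (((Σ q, Fin (k q)) → ZMod (p ^ r)) → Fin n → ZMod (p ^ r))) :
    MeasurableSet {ω | codeword (G ω) (B ω) ∈ S} :=
  hGB.measurableSet_preimage {Z | codeword Z.1 Z.2 ∈ S}

variable [IsFiniteMeasure μ]

lemma measureReal_codeword_eq_and_le (hGB : IsUniformRV μ fun ω => (G ω, B ω)) {s : ℕ}
    {u v : (Σ q, Fin (k q)) → ZMod (p ^ r)}
    (huv : ¬ (p : (Σ q, Fin (k q)) → ZMod (p ^ r)) ^ (s + 1) ∣ u - v)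
    (x y : Fin n → ZMod (p ^ r)) :
    μ.real {ω | codeword (G ω) (B ω) u = x ∧ codeword (G ω) (B ω) v = y} ≤
      (((p : ℝ) ^ r) ^ n * ((p : ℝ) ^ (r - s)) ^ n)⁻¹ := by
  have hp : 0 < p := (Fact.out : p.Prime).pos
  have hcount : (_ : ℝ) ≤ _ := Nat.cast_le.2 (ncard_setOf_codeword_eq_and_mul_le huv x y)
  refine (hGB.measureReal_preimage
    {Z | codeword Z.1 Z.2 u = x ∧ codeword Z.1 Z.2 v = y}).trans_le ?_
  have hcard : 0 < Nat.card (Matrix (Σ q, Fin (k q)) (Fin n) (ZMod (p ^ r))) := Nat.card_pos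
  rw [Nat.card_prod, Nat.card_fun, Nat.card_zmod, Nat.card_fin, inv_eq_one_div,
    div_le_div_iff₀ (by positivity) (by positivity)]
  push_cast at hcount ⊢
  rw [mul_left_comm, one_mul, mul_comm]
  exact mul_le_mul_of_nonneg_right hcount (by positivity)

lemma measureReal_codeword_eq_codeword_le (hGB : IsUniformRV μ fun ω => (G ω, B ω)) {s : ℕ}
    {u v : (Σ q, Fin (k q)) → ZMod (p ^ r)}
    (huv : ¬ (p : (Σ q, Fin (k q)) → ZMod (p ^ r)) ^ (s + 1) ∣ u - v) :
    μ.real {ω | codeword (G ω) (B ω) u = codeword (G ω) (B ω) v} ≤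
      (((p : ℝ) ^ (r - s)) ^ n)⁻¹ := by
  have hp : (p : ℝ) ≠ 0 := Nat.cast_ne_zero.2 (Fact.out : p.Prime).ne_zero
  have hcover : {ω | codeword (G ω) (B ω) u = codeword (G ω) (B ω) v} ⊆ ⋃ x ∈ Set.univ,
      {ω | codeword (G ω) (B ω) u = x ∧ codeword (G ω) (B ω) v = x} := fun ω hω => by
    simpa using hω.symm
  refine (measureReal_mono hcover (measure_ne_top _ _)).trans
    ((measureReal_biUnion_le_ncard_mul Set.finite_univ
    fun x _ => measureReal_codeword_eq_and_le hGB huv x x).trans_eq ?_)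
  rw [Set.ncard_univ, Nat.card_fun, Nat.card_zmod, Nat.card_fin]
  push_cast
  field_simp

end RandomCodewords

section SecondMoment

open MeasureTheory

variable {ι 𝒳 : Type*} [DecidableEq 𝒳]

lemma sq_card_le_card_image_mul_sum (U : Finset ι) (f : ι → 𝒳) :
    (U.card : ℝ) ^ 2 ≤ (U.image f).card * ∑ u ∈ U, ∑ v ∈ U, if f u = f v then 1 else 0 := by
  have hfiber : (U.card : ℝ) = ∑ x ∈ U.image f, ({u ∈ U | f u = x}.card : ℝ) :=
    mod_cast Finset.card_eq_sum_card_image f U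
  have hcoll : ∑ u ∈ U, ∑ v ∈ U, (if f u = f v then (1 : ℝ) else 0) =
      ∑ x ∈ U.image f, ({u ∈ U | f u = x}.card : ℝ) ^ 2 := by
    have hinner (u : ι) :
        ∑ v ∈ U, (if f u = f v then (1 : ℝ) else 0) = {v ∈ U | f v = f u}.card := by
      simp only [eq_comm (a := f u), Finset.sum_boole]
    simp only [hinner, Finset.sum_comp (fun x => ({v ∈ U | f v = x}.card : ℝ)) f, nsmul_eq_mul, sq]
  rw [hcoll, hfiber]
  exact sq_sum_le_card_mul_sum_sq

variable {Ω : Type*} [MeasurableSpace Ω] {μ : Measure Ω} [IsFiniteMeasure μ]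

lemma measureReal_card_image_le {U : Finset ι} (hU : U.Nonempty) {c : Ω → ι → 𝒳}
    (hc : ∀ u ∈ U, ∀ v ∈ U, MeasurableSet {ω | c ω u = c ω v}) {κ : ℝ}
    (hκ : ∀ u ∈ U, ∑ v ∈ U, μ.real {ω | c ω u = c ω v} ≤ κ) {L : ℝ} (hL : 0 ≤ L) :
    μ.real {ω | ((U.image (c ω)).card : ℝ) ≤ L} ≤ L / U.card * κ := by
  have hU0 : (0 : ℝ) < U.card := Nat.cast_pos.2 hU.card_pos
  let collisions (ω : Ω) : ℝ := ∑ u ∈ U, ∑ v ∈ U, Set.indicator {ω | c ω u = c ω v} 1 ω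
  have hint (u : ι) (hu : u ∈ U) (v : ι) (hv : v ∈ U) :
      Integrable ({ω | c ω u = c ω v}.indicator (1 : Ω → ℝ)) μ :=
    (integrable_const 1).indicator (hc u hu v hv)
  have hint_sum : Integrable collisions μ :=
    integrable_finsetSum _ fun u hu => integrable_finsetSum _ fun v hv => hint u hu v hv
  have hmean : ∫ ω, collisions ω ∂μ ≤ U.card * κ := by
    rw [integral_finsetSum _ fun u hu => integrable_finsetSum _ fun v hv => hint u hu v hv,
      ← nsmul_eq_mul]
    refine Finset.sum_le_card_nsmul _ _ _ fun u hu => ?_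
    rw [integral_finsetSum _ fun v hv => hint u hu v hv]
    exact (Finset.sum_congr rfl fun v hv =>
      integral_indicator_one (hc u hu v hv)).trans_le (hκ u hu)
  have hnonneg (ω : Ω) : 0 ≤ collisions ω := Finset.sum_nonneg fun u _ => Finset.sum_nonneg
    fun v _ => Set.indicator_nonneg (fun _ _ => zero_le_one) ω
  have hcover : {ω | ((U.image (c ω)).card : ℝ) ≤ L} ⊆
      {ω | (U.card : ℝ) ^ 2 ≤ L * collisions ω} := fun ω hω =>
    (sq_card_le_card_image_mul_sum U (c ω)).trans (mul_le_mul hω (by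
      simp [collisions, Set.indicator_apply]) (by positivity) hL)
  have hmarkov : (U.card : ℝ) ^ 2 * μ.real {ω | (U.card : ℝ) ^ 2 ≤ L * collisions ω} ≤
      L * (U.card * κ) :=
    (mul_meas_ge_le_integral_of_nonneg (.of_forall fun ω => mul_nonneg hL (hnonneg ω))
      (hint_sum.const_mul L) _).trans ((integral_const_mul L _).trans_le (by gcongr))
  refine (measureReal_mono hcover).trans ?_
  rw [div_mul_eq_mul_div, le_div_iff₀ hU0]
  refine le_of_mul_le_mul_left ?_ hU0
  linarith

end SecondMoment

section RandomCosetCode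

open MeasureTheory Matrix

variable {p r n : ℕ} {𝒬 : Type*} {k : 𝒬 → ℕ}

lemma sum_erase_le_sum_emultiplicity {ι : Type*} [DecidableEq (ι → ZMod (p ^ r))]
    {u : ι → ZMod (p ^ r)} {U : Finset (ι → ZMod (p ^ r))} {A : Finset ℕ}
    (hA : ∀ v ∈ U, v ≠ u → ∃ s ∈ A, emultiplicity (p : ι → ZMod (p ^ r)) (v - u) = s)
    {w : (ι → ZMod (p ^ r)) → ℝ} {κ N : ℕ → ℝ} (hκ : ∀ s ∈ A, 0 ≤ κ s)
    (hw : ∀ v ∈ U, ∀ s ∈ A, emultiplicity (p : ι → ZMod (p ^ r)) (v - u) = s → w v ≤ κ s)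
    (hN : ∀ s ∈ A, ({v | v ∈ U ∧ (p : ι → ZMod (p ^ r)) ^ s ∣ v - u}.ncard : ℝ) ≤ N s) :
    ∑ v ∈ U.erase u, w v ≤ ∑ s ∈ A, N s * κ s := by
  classical
  have hterm (v : ι → ZMod (p ^ r)) (hv : v ∈ U.erase u) :
      w v ≤ ∑ s ∈ A, if (p : ι → ZMod (p ^ r)) ^ s ∣ v - u then κ s else 0 := by
    obtain ⟨hvu, hvU⟩ := Finset.mem_erase.1 hv
    obtain ⟨s, hs, hlevel⟩ := hA v hvU hvu
    refine (hw v hvU s hs hlevel).trans ?_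
    rw [← if_pos (c := (p : ι → ZMod (p ^ r)) ^ s ∣ v - u) (t := κ s) (e := 0)
      (emultiplicity_eq_coe.1 hlevel).1]
    exact Finset.single_le_sum (f := fun s => if (p : ι → ZMod (p ^ r)) ^ s ∣ v - u then κ s else 0)
      (fun s hs => by split_ifs <;> simp [hκ s hs]) hs
  calc ∑ v ∈ U.erase u, w v
      ≤ ∑ v ∈ U, ∑ s ∈ A, if (p : ι → ZMod (p ^ r)) ^ s ∣ v - u then κ s else 0 :=
        (Finset.sum_le_sum hterm).trans <| Finset.sum_le_sum_of_subset_of_nonneg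
          (Finset.erase_subset _ _) fun v _ _ => Finset.sum_nonneg fun s hs => by
            split_ifs <;> simp [hκ s hs]
    _ = ∑ s ∈ A, ({v | v ∈ U ∧ (p : ι → ZMod (p ^ r)) ^ s ∣ v - u}.ncard : ℝ) * κ s := by
        rw [Finset.sum_comm]
        simp only [← Finset.sum_filter, Finset.sum_const, nsmul_eq_mul, ← Finset.coe_filter,
          Set.ncard_coe_finset]
    _ ≤ ∑ s ∈ A, N s * κ s :=
        Finset.sum_le_sum fun s hs => mul_le_mul_of_nonneg_right (hN s hs) (hκ s hs)

variable [Fintype 𝒬]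

lemma pow_dvd_codeword_sub_codeword {s : ℕ} {u v : (Σ q, Fin (k q)) → ZMod (p ^ r)}
    (huv : (p : (Σ q, Fin (k q)) → ZMod (p ^ r)) ^ s ∣ u - v)
    (G : Matrix (Σ q, Fin (k q)) (Fin n) (ZMod (p ^ r))) (b : Fin n → ZMod (p ^ r)) :
    (p : Fin n → ZMod (p ^ r)) ^ s ∣ codeword G b u - codeword G b v := by
  rw [codeword_sub_codeword, pi_dvd_iff]
  exact fun i => Finset.dvd_sum fun j _ => (pi_dvd_iff.1 huv j).mul_right _

variable [Fact p.Prime] {Ω : Type*} [MeasurableSpace Ω] {μ : Measure Ω}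
  {G : Ω → Matrix (Σ q, Fin (k q)) (Fin n) (ZMod (p ^ r))} {B : Ω → Fin n → ZMod (p ^ r)}
  {𝒰 : Set ((Σ q, Fin (k q)) → ZMod (p ^ r))} {A : Finset ℕ} {N : ℕ → ℝ}

lemma measureReal_ncard_image_codeword_le [IsProbabilityMeasure μ]
    (hGB : IsUniformRV μ fun ω => (G ω, B ω)) (h𝒰 : 𝒰.Nonempty)
    (hA : ∀ u ∈ 𝒰, ∀ v ∈ 𝒰, v ≠ u →
      ∃ s ∈ A, emultiplicity (p : (Σ q, Fin (k q)) → ZMod (p ^ r)) (v - u) = s)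
    (hN : ∀ u, ∀ s ∈ A,
      ({v ∈ 𝒰 | (p : (Σ q, Fin (k q)) → ZMod (p ^ r)) ^ s ∣ v - u}.ncard : ℝ) ≤ N s)
    {L : ℝ} (hL : 0 ≤ L) :
    μ.real {ω | ((codeword (G ω) (B ω) '' 𝒰).ncard : ℝ) ≤ L} ≤
      L / 𝒰.ncard * (1 + ∑ s ∈ A, N s * (((p : ℝ) ^ (r - s)) ^ n)⁻¹) := by
  classical
  obtain ⟨U, rfl⟩ := (Set.toFinite 𝒰).exists_finset_coe
  simp only [← Finset.coe_image, Finset.mem_coe, Set.ncard_coe_finset] at hA hN ⊢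
  refine measureReal_card_image_le (Finset.coe_nonempty.1 h𝒰)
    (fun u _ v _ => measurableSet_setOf_codeword hGB {f | f u = f v}) (fun u hu => ?_) hL
  rw [← Finset.add_sum_erase _ _ hu]
  refine add_le_add measureReal_le_one (sum_erase_le_sum_emultiplicity (hA u hu)
    (fun s _ => by positivity) (fun v _ s _ hlevel => ?_) (hN u))
  simpa only [eq_comm] using
    measureReal_codeword_eq_codeword_le hGB (emultiplicity_eq_coe.1 hlevel).2

lemma measureReal_exists_codeword_mem_le [IsFiniteMeasure μ] {𝒴 : Type*} [Finite 𝒴]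
    {W : ZMod (p ^ r) → PMF 𝒴} {Y : Ω → Fin n → 𝒴} {u₀ : (Σ q, Fin (k q)) → ZMod (p ^ r)}
    (hGB : IsUniformRV μ fun ω => (G ω, B ω))
    (hY : IsChannelOutput μ W 𝒰 (fun u ω => codeword (G ω) (B ω) u) u₀ Y) (hu₀ : u₀ ∈ 𝒰)
    (hA : ∀ v ∈ 𝒰, v ≠ u₀ →
      ∃ s ∈ A, emultiplicity (p : (Σ q, Fin (k q)) → ZMod (p ^ r)) (v - u₀) = s)
    (hN : ∀ s ∈ A,
      ({v ∈ 𝒰 | (p : (Σ q, Fin (k q)) → ZMod (p ^ r)) ^ s ∣ v - u₀}.ncard : ℝ) ≤ N s)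
    {T : Set (Fin n → ZMod (p ^ r) × 𝒴)} {M : ℕ → ℝ}
    (hM : ∀ s ∈ A, ∀ (x₀ : Fin n → ZMod (p ^ r)) (y : Fin n → 𝒴),
      ({x | (fun i => (x i, y i)) ∈ T ∧
        (p : Fin n → ZMod (p ^ r)) ^ s ∣ x - x₀}.ncard : ℝ) ≤ M s) :
    μ.real {ω | ∃ x ∈ codeword (G ω) (B ω) '' 𝒰,
        (fun i => (x i, Y ω i)) ∈ T ∧ x ≠ codeword (G ω) (B ω) u₀} ≤
      ∑ s ∈ A, N s * (M s * (((p : ℝ) ^ (r - s)) ^ n)⁻¹) := by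
  classical
  obtain ⟨U, rfl⟩ := (Set.toFinite 𝒰).exists_finset_coe
  simp only [Finset.mem_coe] at hA hN
  have hp : (0 : ℝ) < p := Nat.cast_pos.2 (Fact.out : p.Prime).pos
  obtain ⟨y₀, -⟩ := (W 0).support_nonempty
  have hcover : {ω | ∃ x ∈ codeword (G ω) (B ω) '' U,
      (fun i => (x i, Y ω i)) ∈ T ∧ x ≠ codeword (G ω) (B ω) u₀} ⊆
      ⋃ v ∈ U.erase u₀, {ω | (fun i => (codeword (G ω) (B ω) v i, Y ω i)) ∈ T} := by
    rintro ω ⟨_, ⟨v, hv, rfl⟩, hT, hne⟩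
    exact Set.mem_biUnion (Finset.mem_erase.2 ⟨fun h => hne (h ▸ rfl), hv⟩) hT
  refine (measureReal_mono hcover (measure_ne_top _ _)).trans
    ((measureReal_biUnion_finset_le _ _).trans ?_)
  refine sum_erase_le_sum_emultiplicity hA (fun s hs =>
    mul_nonneg ((Nat.cast_nonneg _).trans (hM s hs 0 fun _ => y₀)) (by positivity))
    (fun v hv s hs hlevel => ?_) hN
  obtain ⟨hdvd, hndvd⟩ := emultiplicity_eq_coe.1 hlevel
  have hbound := hY.measureReal_mem_le
    (fun v _ x => measurableSet_setOf_codeword hGB {f | f v = x}) hv hu₀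
    (measureReal_codeword_eq_and_le hGB hndvd) (hM s hs)
  refine le_trans (measureReal_mono fun ω hω => ?_) (hbound.trans_eq ?_)
  · exact ⟨hω, pow_dvd_codeword_sub_codeword hdvd (G ω) (B ω)⟩
  rw [Nat.card_fun, Nat.card_zmod, Nat.card_fin]
  push_cast
  field_simp

end RandomCosetCode

section Exponents

lemma abs_sum_mul_sub_le_sum_abs {𝒬 : Type*} [Fintype 𝒬] {P : 𝒬 → ℝ} {k : 𝒬 → ℕ} {n : ℕ} {c : ℝ}
    (hk : ∀ q, |(k q : ℝ) - c * n * P q| ≤ 1) (x : 𝒬 → ℝ) :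
    |∑ q, k q * x q - n * (c * ∑ q, P q * x q)| ≤ ∑ q, |x q| := by
  have hdiff : ∑ q, k q * x q - n * (c * ∑ q, P q * x q) = ∑ q, (k q - c * n * P q) * x q := by
    simp only [Finset.mul_sum, ← Finset.sum_sub_distrib]
    exact Finset.sum_congr rfl fun q _ => by ring
  rw [hdiff]
  refine (Finset.abs_sum_le_sum_abs _ _).trans (Finset.sum_le_sum fun q _ => ?_)
  rw [abs_mul]
  exact mul_le_of_le_one_left (abs_nonneg _) (hk q)

lemma eventually_forall_le_of_abs_sub_le {𝒬 : Type*} [Finite 𝒬] {P : 𝒬 → ℝ} (hP : ∀ q, 0 < P q)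
    {c : ℝ} (hc : 0 < c) (K : ℝ) :
    ∀ᶠ n : ℕ in Filter.atTop, ∀ k : 𝒬 → ℕ, (∀ q, |(k q : ℝ) - c * n * P q| ≤ 1) →
      ∀ q, K ≤ k q := by
  have hlong (q : 𝒬) : ∀ᶠ n : ℕ in Filter.atTop, K + 1 ≤ c * n * P q :=
    ((tendsto_natCast_atTop_atTop.const_mul_atTop hc).atTop_mul_const (hP q)).eventually_ge_atTop _
  filter_upwards [Filter.eventually_all.2 hlong] with n hn k hk q
  linarith [(abs_le.1 (hk q)).1, hn q]

lemma inv_pow_eq_two_rpow {x : ℝ} (hx : 0 < x) (n : ℕ) :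
    (x ^ n)⁻¹ = (2 : ℝ) ^ (-(n * Real.logb 2 x)) := by
  rw [Real.rpow_neg zero_le_two, mul_comm, Real.rpow_mul zero_le_two,
    Real.rpow_logb two_pos one_lt_two.ne' hx, Real.rpow_natCast]

lemma tendsto_const_mul_two_rpow_sub_mul {x : ℝ} (hx : 0 < x) (a b : ℝ) :
    Filter.Tendsto (fun n : ℕ => a * (2 : ℝ) ^ (b - n * x)) Filter.atTop (𝓝 0) := by
  rw [← mul_zero a]
  refine .const_mul _ ((tendsto_rpow_atBot_of_base_gt_one 2 one_lt_two).comp ?_)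
  exact Filter.tendsto_atBot_add_const_left _ _ <|
    Filter.tendsto_neg_atTop_atBot.comp (tendsto_natCast_atTop_atTop.atTop_mul_const hx)

lemma two_rpow_div_mul_one_add_sum_le {ι : Type*} {A : Finset ι} {f : ι → ℝ} {x u M E : ℝ}
    (hM : (2 : ℝ) ^ u ≤ M) (hx : x - u ≤ E) (hf : ∀ s ∈ A, x - u + f s ≤ E) :
    (2 : ℝ) ^ x / M * (1 + ∑ s ∈ A, (2 : ℝ) ^ f s) ≤ (A.card + 1) * (2 : ℝ) ^ E := by
  calc (2 : ℝ) ^ x / M * (1 + ∑ s ∈ A, (2 : ℝ) ^ f s)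
      ≤ (2 : ℝ) ^ x / (2 : ℝ) ^ u * (1 + ∑ s ∈ A, (2 : ℝ) ^ f s) := by gcongr
    _ = (2 : ℝ) ^ (x - u) + ∑ s ∈ A, (2 : ℝ) ^ (x - u + f s) := by
        simp only [← Real.rpow_sub two_pos, mul_add, mul_one, Finset.mul_sum,
          ← Real.rpow_add two_pos]
    _ ≤ (2 : ℝ) ^ E + A.card * (2 : ℝ) ^ E := by
        rw [← nsmul_eq_mul]
        exact add_le_add (Real.rpow_le_rpow_of_exponent_le one_le_two hx)
          (Finset.sum_le_card_nsmul _ _ _ fun s hs =>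
            Real.rpow_le_rpow_of_exponent_le one_le_two (hf s hs))
    _ = (A.card + 1) * (2 : ℝ) ^ E := by ring

lemma ncard_le_rpow_of_rate_lt {α : Type*} {n : ℕ} (hn : n ≠ 0) {C : Set (Fin n → α)} {m : ℝ}
    (hC : rate C < m) : (C.ncard : ℝ) ≤ (2 : ℝ) ^ (n * m) := by
  rcases C.ncard.eq_zero_or_pos with h0 | hpos
  · rw [h0, Nat.cast_zero]
    positivity
  rw [rate, div_lt_iff₀' (Nat.cast_pos.2 (Nat.pos_of_ne_zero hn)),
    Real.logb_lt_iff_lt_rpow one_lt_two (Nat.cast_pos.2 hpos)] at hC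
  exact hC.le

/- In the next two lemmas `R` is the minimum of the bounds `H / H_s * (a_s - h_s - 4 * Δ)` on
the rate. If some level `t` has too many index vectors, then `R` falls short of the logarithm
`c * H` of the size of the index set, and of the exponent at which collisions at level `s`
become typical. -/
lemma le_sub_of_le_div_mul {c H Ht a h Δ R : ℝ} (hHt : 0 < Ht) (hHtH : Ht ≤ H) (hΔ : 0 ≤ Δ)
    (ht : a - h - 2 * Δ < c * Ht) (hR : R ≤ H / Ht * (a - h - 4 * Δ)) : R ≤ c * H - 2 * Δ := by
  have hratio : 1 ≤ H / Ht := (one_le_div hHt).2 hHtH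
  calc R ≤ H / Ht * (a - h - 4 * Δ) := hR
    _ ≤ H / Ht * (c * Ht - 2 * Δ) := mul_le_mul_of_nonneg_left (by linarith) (by linarith)
    _ = c * H - H / Ht * (2 * Δ) := by field_simp
    _ ≤ c * H - 2 * Δ := by nlinarith

lemma le_sub_add_sub_of_le_div_mul {c H Hs a h Δ R : ℝ} (hHs : 0 < Hs) (hHsH : Hs ≤ H)
    (hh : 0 ≤ h) (hΔ : 0 ≤ Δ) (hR : R ≤ c * H - 2 * Δ) (hRs : R ≤ H / Hs * (a - h - 4 * Δ)) :
    R ≤ c * H - c * Hs + a - 2 * Δ := by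
  rcases le_or_gt (c * Hs) a with hle | hlt
  · linarith
  have hratio : 1 ≤ H / Hs := (one_le_div hHs).2 hHsH
  have hexcess : (H / Hs - 1) * a ≤ c * H - c * Hs :=
    calc (H / Hs - 1) * a ≤ (H / Hs - 1) * (c * Hs) :=
          mul_le_mul_of_nonneg_left hlt.le (by linarith)
      _ = c * H - c * Hs := by field_simp
  have hloss : h + 4 * Δ ≤ H / Hs * (h + 4 * Δ) := le_mul_of_one_le_left (by positivity) hratio
  linarith

end Exponents

section Ensemble

variable {p r : ℕ} [Fact p.Prime] {𝒬 𝒴 : Type*} [Fintype 𝒬] [Fintype 𝒴]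
  (PQ : PMF 𝒬) (PU : 𝒬 → PMF (ZMod (p ^ r))) (PX : PMF (ZMod (p ^ r)))
  (W : ZMod (p ^ r) → PMF 𝒴) (c : ℝ)

/-- The entropy `H(U|Q)`. -/
def indexEntropy : ℝ := condEntropy (pairLaw PQ PU) (fun t => t.2) fun t => t.1

/-- The entropy `H(U|Q,[U]_s)`. -/
def truncEntropy (s : ℕ) : ℝ :=
  condEntropy (pairLaw PQ PU) (fun t => t.2) fun t => (t.1, trunc p r s t.2)

/-- The entropy `H(X|Y,[X]_s)`. -/
def outputEntropy (s : ℕ) : ℝ :=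
  condEntropy (pairLaw PX W) (fun t => t.1) fun t => (t.2, trunc p r s t.1)

/-- The levels `s < r` with `H(U|Q,[U]_s) ≠ 0`. Only at these can two distinct index vectors
first differ, and only these constrain the rate. -/
def activeLevels : Finset ℕ := {s ∈ Finset.range r | truncEntropy PQ PU s ≠ 0}

/-- The mean over `Q` of the typicality factor `logDev` of the laws `P_{U|Q=q}`. -/
def indexDev : ℝ := ∑ q, (PQ q).toReal * logDev (PU q)

/-- The factor `D` such that a tolerance `ε` in the typicality conditions costs at most `D ε`
in each of the exponents that occur. The summand `1` makes it positive, so that a margin of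
`D ε` in an exponent yields exponential decay. -/
def slack : ℝ := 1 + 2 * (c * indexDev PQ PU) + logDev (pairLaw PX W)

/-- A bound, uniform in the block lengths `k q`, for the error in the exponents caused by
rounding `c n P_Q(q)` to the integer `k q`. -/
def roundingError (ε : ℝ) : ℝ :=
  ∑ q, (1 + (condEntropy (PU q) id (fun _ => ()) + ε * logDev (PU q)))

lemma condEntropy_snd_pairLaw {β γ : Type*} [Fintype β] [Fintype γ]
    {g : 𝒬 × ZMod (p ^ r) → β} {g' : ZMod (p ^ r) → γ}
    (hg : ∀ q a q' a', g (q, a) = g (q', a') ↔ q = q' ∧ g' a = g' a') :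
    condEntropy (pairLaw PQ PU) (fun t => t.2) g =
      ∑ q, (PQ q).toReal * condEntropy (PU q) id g' := by
  rw [condEntropy_eq_condEntropy_id _ fun _ _ h => ?_, condEntropy_id_pairLaw PQ PU hg]
  exact Prod.ext ((hg _ _ _ _).1 (Prod.mk.inj h).2).1 (Prod.mk.inj h).1

lemma indexEntropy_eq_sum :
    indexEntropy PQ PU = ∑ q, (PQ q).toReal * condEntropy (PU q) id fun _ => () :=
  condEntropy_snd_pairLaw PQ PU fun _ _ _ _ => (and_iff_left rfl).symm

lemma truncEntropy_eq_sum (s : ℕ) :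
    truncEntropy PQ PU s = ∑ q, (PQ q).toReal * condEntropy (PU q) id (trunc p r s) :=
  condEntropy_snd_pairLaw PQ PU fun _ _ _ _ => Prod.mk_inj

lemma truncEntropy_nonneg (s : ℕ) : 0 ≤ truncEntropy PQ PU s := by
  rw [truncEntropy_eq_sum]
  exact Finset.sum_nonneg fun q _ => mul_nonneg ENNReal.toReal_nonneg (condEntropy_id_nonneg _ _)

lemma truncEntropy_le_indexEntropy (s : ℕ) : truncEntropy PQ PU s ≤ indexEntropy PQ PU := by
  rw [truncEntropy_eq_sum, indexEntropy_eq_sum]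
  exact Finset.sum_le_sum fun q _ =>
    mul_le_mul_of_nonneg_left (condEntropy_id_le_const _ _) ENNReal.toReal_nonneg

lemma outputEntropy_eq_condEntropy_id (s : ℕ) : outputEntropy PX W s =
    condEntropy (pairLaw PX W) id fun t => (t.2, trunc p r s t.1) :=
  condEntropy_eq_condEntropy_id _ fun _ _ h =>
    Prod.ext (Prod.mk.inj h).1 (Prod.mk.inj (Prod.mk.inj h).2).1

lemma outputEntropy_nonneg (s : ℕ) : 0 ≤ outputEntropy PX W s := by
  rw [outputEntropy_eq_condEntropy_id]
  exact condEntropy_id_nonneg _ _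

lemma card_activeLevels_le : (activeLevels PQ PU).card ≤ r :=
  (Finset.card_filter_le _ _).trans_eq (Finset.card_range r)

lemma indexDev_nonneg : 0 ≤ indexDev PQ PU :=
  Finset.sum_nonneg fun _ _ => mul_nonneg ENNReal.toReal_nonneg (logDev_nonneg _)

variable {c} in
lemma slack_pos (hc : 0 ≤ c) : 0 < slack PQ PU PX W c := by
  have := mul_nonneg hc (indexDev_nonneg PQ PU)
  have := logDev_nonneg (pairLaw PX W)
  unfold slack
  linarith

variable {ε : ℝ}

lemma roundingError_nonneg (hε : 0 ≤ ε) : 0 ≤ roundingError PU ε :=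
  Finset.sum_nonneg fun _ _ => add_nonneg zero_le_one <|
    add_nonneg (condEntropy_id_nonneg _ _) (mul_nonneg hε (logDev_nonneg _))

variable {PQ PU c} {s : ℕ}

lemma lt_of_mem_activeLevels (hs : s ∈ activeLevels PQ PU) : s < r :=
  Finset.mem_range.1 (Finset.mem_filter.1 hs).1

lemma truncEntropy_pos_of_mem_activeLevels (hs : s ∈ activeLevels PQ PU) :
    0 < truncEntropy PQ PU s :=
  (truncEntropy_nonneg PQ PU s).lt_of_ne' (Finset.mem_filter.1 hs).2

variable {k : 𝒬 → ℕ} {n : ℕ}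

lemma exists_mem_activeLevels_emultiplicity_sub_eq (hPQ : ∀ q, PQ q ≠ 0)
    {u v : (Σ q, Fin (k q)) → ZMod (p ^ r)} (hu : u ∈ indexSet PU ε k)
    (hv : v ∈ indexSet PU ε k) (huv : u ≠ v) :
    ∃ s ∈ activeLevels PQ PU,
      emultiplicity (p : (Σ q, Fin (k q)) → ZMod (p ^ r)) (u - v) = s := by
  obtain ⟨s, hs, hlevel⟩ := exists_lt_emultiplicity_sub_eq huv
  refine ⟨s, Finset.mem_filter.2 ⟨Finset.mem_range.2 hs, fun h0 => huv ?_⟩, hlevel⟩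
  rw [truncEntropy_eq_sum, Finset.sum_eq_zero_iff_of_nonneg fun q _ =>
    mul_nonneg ENNReal.toReal_nonneg (condEntropy_id_nonneg _ _)] at h0
  have hentropy (q : 𝒬) : condEntropy (PU q) id (trunc p r s) = 0 :=
    (mul_eq_zero.1 (h0 q (Finset.mem_univ q))).resolve_left (toReal_pos_of_ne_zero (hPQ q)).ne'
  exact injOn_indexSet_of_condEntropy_eq_zero hentropy ε k hu hv
    ((trunc_comp_eq_trunc_comp_iff hs.le u v).2 (emultiplicity_eq_coe.1 hlevel).1)

lemma ncard_indexSet_pow_dvd_le (hε : 0 ≤ ε) (hk : ∀ q, |(k q : ℝ) - c * n * (PQ q).toReal| ≤ 1)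
    (hs : s ≤ r) (u : (Σ q, Fin (k q)) → ZMod (p ^ r)) :
    ({v ∈ indexSet PU ε k | (p : (Σ q, Fin (k q)) → ZMod (p ^ r)) ^ s ∣ v - u}.ncard : ℝ) ≤
      (2 : ℝ) ^ (n * (c * truncEntropy PQ PU s + ε * (c * indexDev PQ PU)) +
        roundingError PU ε) := by
  let e (q : 𝒬) : ℝ := condEntropy (PU q) id (trunc p r s) + ε * logDev (PU q)
  have he (q : 𝒬) : 0 ≤ e q :=
    add_nonneg (condEntropy_id_nonneg _ _) (mul_nonneg hε (logDev_nonneg _))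
  have hmean : ∑ q, (PQ q).toReal * e q = truncEntropy PQ PU s + ε * indexDev PQ PU := by
    simp only [e, truncEntropy_eq_sum, indexDev, Finset.mul_sum, ← Finset.sum_add_distrib]
    exact Finset.sum_congr rfl fun q _ => by ring
  have hround : ∑ q, |e q| ≤ roundingError PU ε := Finset.sum_le_sum fun q _ => by
    rw [abs_of_nonneg (he q)]
    linarith [condEntropy_id_le_const (PU q) (trunc p r s)]
  simp only [← trunc_comp_eq_trunc_comp_iff hs, funext_iff, Function.comp_apply]
  refine (ncard_indexSet_fiber_le PU (trunc p r s) ε fun j => trunc p r s (u j)).trans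
    (Real.rpow_le_rpow_of_exponent_le one_le_two ?_)
  have hdiff := (abs_le.1 (abs_sum_mul_sub_le_sum_abs hk e)).2
  rw [hmean] at hdiff
  linarith

lemma rpow_sub_roundingError_le_ncard_indexSet (hε : 0 < ε)
    (hk : ∀ q, |(k q : ℝ) - c * n * (PQ q).toReal| ≤ 1)
    (hlong : ∀ q, ((p : ℝ) ^ r) ^ 3 / (2 * ε ^ 2) ≤ k q) :
    (2 : ℝ) ^ (n * (c * indexEntropy PQ PU - ε * (c * indexDev PQ PU)) - roundingError PU ε) ≤
      (indexSet PU ε k).ncard := by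
  let e (q : 𝒬) : ℝ := condEntropy (PU q) id (fun _ => ()) - ε * logDev (PU q)
  have hmean : ∑ q, (PQ q).toReal * e q = indexEntropy PQ PU - ε * indexDev PQ PU := by
    simp only [e, indexEntropy_eq_sum, indexDev, Finset.mul_sum, ← Finset.sum_sub_distrib]
    exact Finset.sum_congr rfl fun q _ => by ring
  have hround : ∑ q, (|e q| + 1) ≤ roundingError PU ε := Finset.sum_le_sum fun q _ => by
    have hH := condEntropy_id_nonneg (PU q) fun _ => ()
    have hV := mul_nonneg hε.le (logDev_nonneg (PU q))
    linarith [abs_le.2 (show _ ∧ e q ≤ condEntropy (PU q) id (fun _ => ()) + ε * logDev (PU q) from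
      ⟨by simp only [e]; linarith, by simp only [e]; linarith⟩)]
  refine le_trans (Real.rpow_le_rpow_of_exponent_le one_le_two ?_)
    (rpow_le_ncard_indexSet PU hε hlong)
  have hdiff := (abs_le.1 (abs_sum_mul_sub_le_sum_abs hk e)).1
  rw [hmean] at hdiff
  rw [Finset.sum_add_distrib] at hround
  rw [Finset.sum_sub_distrib]
  linarith

lemma ncard_typicalSet_pow_dvd_le (hs : s ≤ r) (x₀ : Fin n → ZMod (p ^ r)) (y : Fin n → 𝒴) :
    ({x | (fun i => (x i, y i)) ∈ typicalSet (pairLaw PX W) ε n ∧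
        (p : Fin n → ZMod (p ^ r)) ^ s ∣ x - x₀}.ncard : ℝ) ≤
      (2 : ℝ) ^ (n * (outputEntropy PX W s + ε * logDev (pairLaw PX W))) := by
  rw [outputEntropy_eq_condEntropy_id]
  refine le_trans (Nat.cast_le.2 ?_) (ncard_typicalSet_fiber_le (pairLaw PX W)
    (fun t => (t.2, trunc p r s t.1)) ε fun i => (y i, trunc p r s (x₀ i)))
  refine Set.ncard_le_ncard_of_injOn (fun x i => (x i, y i)) (fun x hx => ⟨hx.1, fun i => ?_⟩)
    fun x _ x' _ h => funext fun i => (Prod.mk.inj (congrFun h i)).1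
  exact Prod.ext rfl (congrFun ((trunc_comp_eq_trunc_comp_iff hs x x₀).2 hx.2) i)

end Ensemble

section ErrorProbability

open MeasureTheory

variable {p r : ℕ} [Fact p.Prime] {𝒬 𝒴 : Type*} [Fintype 𝒬] [Fintype 𝒴]
  {PQ : PMF 𝒬} {PU : 𝒬 → PMF (ZMod (p ^ r))} {PX : PMF (ZMod (p ^ r))}
  {W : ZMod (p ^ r) → PMF 𝒴} {c ε : ℝ} {n : ℕ} {k : 𝒬 → ℕ}
  {Ω : Type*} [MeasurableSpace Ω] {μ : Measure Ω} [IsProbabilityMeasure μ]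
  {G : Ω → Matrix (Σ q, Fin (k q)) (Fin n) (ZMod (p ^ r))} {B : Ω → Fin n → ZMod (p ^ r)}
  {Y : Ω → Fin n → 𝒴} {u₀ : (Σ q, Fin (k q)) → ZMod (p ^ r)}

variable (PQ PU PX W c ε) in
/-- The bound `H(U|Q) / H(U|Q,[U]_s) * (log₂ p^{r-s} - H(X|Y,[X]_s) + η)` on the rate at level
`s`, with the correction `η = -4 D ε` in terms of the factor `D` of `slack`. -/
def rateBound (s : ℕ) : ℝ :=
  indexEntropy PQ PU / truncEntropy PQ PU s *
    (Real.logb 2 ((p : ℝ) ^ (r - s)) - outputEntropy PX W s +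
      -(4 * (slack PQ PU PX W c * ε)))

lemma measureReal_exists_typical_le (hc : 0 ≤ c) (hε : 0 ≤ ε) (hPQ : ∀ q, PQ q ≠ 0)
    (hk : ∀ q, |(k q : ℝ) - c * n * (PQ q).toReal| ≤ 1) (hu₀ : u₀ ∈ indexSet PU ε k)
    (hGB : IsUniformRV μ fun ω => (G ω, B ω))
    (hY : IsChannelOutput μ W (indexSet PU ε k) (fun u ω => codeword (G ω) (B ω) u) u₀ Y)
    (hfew : ∀ s ∈ activeLevels PQ PU, c * truncEntropy PQ PU s ≤
      Real.logb 2 ((p : ℝ) ^ (r - s)) - outputEntropy PX W s -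
        2 * (slack PQ PU PX W c * ε)) :
    μ.real {ω | ∃ x ∈ code PU ε (G ω) (B ω),
        (fun i => (x i, Y ω i)) ∈ typicalSet (pairLaw PX W) ε n ∧
        x ≠ codeword (G ω) (B ω) u₀} ≤
      r * (2 : ℝ) ^ (2 * roundingError PU ε - n * (slack PQ PU PX W c * ε)) := by
  have hp : (0 : ℝ) < p := Nat.cast_pos.2 (Fact.out : p.Prime).pos
  refine (measureReal_exists_codeword_mem_le hGB hY hu₀
    (fun v hv hne => exists_mem_activeLevels_emultiplicity_sub_eq hPQ hv hu₀ hne)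
    (fun s hs => ncard_indexSet_pow_dvd_le hε hk (lt_of_mem_activeLevels hs).le u₀)
    (fun s hs => ncard_typicalSet_pow_dvd_le PX W (lt_of_mem_activeLevels hs).le)).trans ?_
  refine (Finset.sum_le_card_nsmul _ _ _ fun s hs => ?_).trans
    ((nsmul_eq_mul _ _).trans_le <| mul_le_mul_of_nonneg_right
      (Nat.cast_le.2 (card_activeLevels_le PQ PU)) (by positivity))
  rw [inv_pow_eq_two_rpow (pow_pos hp _), ← Real.rpow_add two_pos, ← Real.rpow_add two_pos]
  refine Real.rpow_le_rpow_of_exponent_le one_le_two ?_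
  have hb := roundingError_nonneg PU hε
  have hexp : c * truncEntropy PQ PU s + ε * (c * indexDev PQ PU) +
      (outputEntropy PX W s + ε * logDev (pairLaw PX W)) -
        Real.logb 2 ((p : ℝ) ^ (r - s)) ≤ -(slack PQ PU PX W c * ε) := by
    have hdev := mul_nonneg hε (mul_nonneg hc (indexDev_nonneg PQ PU))
    have hs' := hfew s hs
    unfold slack at hs' ⊢
    linarith
  linarith [mul_le_mul_of_nonneg_left hexp n.cast_nonneg]

lemma measureReal_forall_rate_lt_le (hc : 0 ≤ c) (hε : 0 < ε) (hPQ : ∀ q, PQ q ≠ 0)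
    (hn : n ≠ 0) (hk : ∀ q, |(k q : ℝ) - c * n * (PQ q).toReal| ≤ 1)
    (hlong : ∀ q, ((p : ℝ) ^ r) ^ 3 / (2 * ε ^ 2) ≤ k q) (hne : (indexSet PU ε k).Nonempty)
    (hGB : IsUniformRV μ fun ω => (G ω, B ω)) {t : ℕ} (ht : t ∈ activeLevels PQ PU)
    (hmany : Real.logb 2 ((p : ℝ) ^ (r - t)) - outputEntropy PX W t -
      2 * (slack PQ PU PX W c * ε) < c * truncEntropy PQ PU t) :
    μ.real {ω | ∀ s ∈ activeLevels PQ PU,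
        rate (code PU ε (G ω) (B ω)) < rateBound PQ PU PX W c ε s} ≤
      (r + 1) * (2 : ℝ) ^ (2 * roundingError PU ε - n * (slack PQ PU PX W c * ε)) := by
  have hp : (0 : ℝ) < p := Nat.cast_pos.2 (Fact.out : p.Prime).pos
  have hΔ : 0 ≤ slack PQ PU PX W c * ε := mul_nonneg (slack_pos PQ PU PX W hc).le hε.le
  have hb := roundingError_nonneg PU hε.le
  have hdev : 2 * (ε * (c * indexDev PQ PU)) ≤ slack PQ PU PX W c * ε := by
    have := mul_nonneg (logDev_nonneg (pairLaw PX W)) hε.le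
    unfold slack
    linarith
  obtain ⟨t', ht', hmin⟩ := Finset.exists_min_image _ (rateBound PQ PU PX W c ε) ⟨t, ht⟩
  set R := rateBound PQ PU PX W c ε t'
  have hRt : R ≤ c * indexEntropy PQ PU - 2 * (slack PQ PU PX W c * ε) :=
    le_sub_of_le_div_mul (truncEntropy_pos_of_mem_activeLevels ht)
      (truncEntropy_le_indexEntropy PQ PU t) hΔ hmany (hmin t ht)
  have hRs (s : ℕ) (hs : s ∈ activeLevels PQ PU) : R ≤ c * indexEntropy PQ PU -
      c * truncEntropy PQ PU s + Real.logb 2 ((p : ℝ) ^ (r - s)) -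
        2 * (slack PQ PU PX W c * ε) :=
    le_sub_add_sub_of_le_div_mul (truncEntropy_pos_of_mem_activeLevels hs)
      (truncEntropy_le_indexEntropy PQ PU s) (outputEntropy_nonneg PX W s) hΔ hRt (hmin s hs)
  refine le_trans (measureReal_mono
    (s₂ := {ω | ((code PU ε (G ω) (B ω)).ncard : ℝ) ≤ (2 : ℝ) ^ (n * R)})
    fun ω hω => ncard_le_rpow_of_rate_lt hn (hω t' ht'))
    ((measureReal_ncard_image_codeword_le hGB hne
      (fun u hu v hv huv => exists_mem_activeLevels_emultiplicity_sub_eq hPQ hv hu huv)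
      (fun u s hs => ncard_indexSet_pow_dvd_le hε.le hk (lt_of_mem_activeLevels hs).le u)
      (by positivity)).trans ?_)
  simp only [inv_pow_eq_two_rpow (pow_pos hp _), ← Real.rpow_add two_pos]
  refine (two_rpow_div_mul_one_add_sum_le
    (rpow_sub_roundingError_le_ncard_indexSet hε hk hlong) ?_ fun s hs => ?_).trans
      (mul_le_mul_of_nonneg_right (by gcongr; exact card_activeLevels_le PQ PU) (by positivity))
  · linarith [mul_le_mul_of_nonneg_left hRt n.cast_nonneg,
      mul_le_mul_of_nonneg_left hdev n.cast_nonneg, mul_nonneg n.cast_nonneg hΔ]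
  · linarith [mul_le_mul_of_nonneg_left (hRs s hs) n.cast_nonneg,
      mul_le_mul_of_nonneg_left hdev n.cast_nonneg]

lemma measureReal_rate_lt_and_exists_typical_le (hc : 0 ≤ c) (hε : 0 < ε)
    (hPQ : ∀ q, PQ q ≠ 0) (hn : n ≠ 0) (hk : ∀ q, |(k q : ℝ) - c * n * (PQ q).toReal| ≤ 1)
    (hlong : ∀ q, ((p : ℝ) ^ r) ^ 3 / (2 * ε ^ 2) ≤ k q)
    (hu₀ : u₀ ∈ indexSet PU ε k) (hGB : IsUniformRV μ fun ω => (G ω, B ω))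
    (hY : IsChannelOutput μ W (indexSet PU ε k) (fun u ω => codeword (G ω) (B ω) u) u₀ Y) :
    μ.real {ω | (∀ s ∈ activeLevels PQ PU,
          rate (code PU ε (G ω) (B ω)) < rateBound PQ PU PX W c ε s) ∧
        ∃ x ∈ code PU ε (G ω) (B ω),
          (fun i => (x i, Y ω i)) ∈ typicalSet (pairLaw PX W) ε n ∧
          x ≠ codeword (G ω) (B ω) u₀} ≤
      (r + 1) * (2 : ℝ) ^ (2 * roundingError PU ε - n * (slack PQ PU PX W c * ε)) := by
  by_cases hfew : ∀ s ∈ activeLevels PQ PU, c * truncEntropy PQ PU s ≤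
      Real.logb 2 ((p : ℝ) ^ (r - s)) - outputEntropy PX W s - 2 * (slack PQ PU PX W c * ε)
  · refine (measureReal_mono fun ω hω => hω.2).trans
      ((measureReal_exists_typical_le hc hε.le hPQ hk hu₀ hGB hY hfew).trans ?_)
    gcongr
    exact le_add_of_nonneg_right zero_le_one
  · push Not at hfew
    obtain ⟨t, ht, hmany⟩ := hfew
    exact (measureReal_mono fun ω hω => hω.1).trans
      (measureReal_forall_rate_lt_le hc hε hPQ hn hk hlong ⟨u₀, hu₀⟩ hGB ht hmany)

end ErrorProbability

end QGC

end

theorem mainTheorem5 {p r : ℕ} [Fact p.Prime] {𝒬 𝒴 : Type*} [Fintype 𝒬] [Fintype 𝒴]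
    (PQ : PMF 𝒬) (hPQ : ∀ q, 0 < PQ q) (PU : 𝒬 → PMF (ZMod (p ^ r)))
    (PX : PMF (ZMod (p ^ r))) (W : ZMod (p ^ r) → PMF 𝒴) (c : ℝ) (hc : 0 < c) :
    ∃ η : ℝ → ℝ, Filter.Tendsto η (𝓝[>] 0) (𝓝 0) ∧
      ∀ ε > 0, ∀ δ > 0, ∃ N : ℕ, ∀ n > N,
        -- block lengths: `c n P_Q(q)`, rounded up or down if it is not an integer
        ∀ k : 𝒬 → ℕ, (∀ q, |(k q : ℝ) - c * n * (PQ q).toReal| < 1) →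
        ∀ u₀ ∈ QGC.indexSet PU ε k,
        ∀ (Ω : Type*) [MeasurableSpace Ω] (μ : MeasureTheory.Measure Ω)
          [MeasureTheory.IsProbabilityMeasure μ]
          (G : Ω → Matrix (Σ q, Fin (k q)) (Fin n) (ZMod (p ^ r)))
          (B : Ω → Fin n → ZMod (p ^ r)) (Y : Ω → Fin n → 𝒴),
          QGC.IsUniformRV μ (fun ω => (G ω, B ω)) →
          QGC.IsChannelOutput μ W (QGC.indexSet PU ε k)
            (fun u ω => QGC.codeword (G ω) (B ω) u) u₀ Y →
          μ.real {ω |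
            -- the rate condition; an index `s` with `H(U|Q,[U]_s) = 0` imposes no constraint
            (∀ s < r,
              QGC.condEntropy (QGC.pairLaw PQ PU) (fun t => t.2)
                (fun t => (t.1, QGC.trunc p r s t.2)) ≠ 0 →
              QGC.rate (QGC.code PU ε (G ω) (B ω)) <
                QGC.condEntropy (QGC.pairLaw PQ PU) (fun t => t.2) (fun t => t.1) /
                  QGC.condEntropy (QGC.pairLaw PQ PU) (fun t => t.2)
                    (fun t => (t.1, QGC.trunc p r s t.2)) *
                (Real.logb 2 ((p : ℝ) ^ (r - s)) -
                  QGC.condEntropy (QGC.pairLaw PX W) (fun t => t.1)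
                    (fun t => (t.2, QGC.trunc p r s t.1)) + η ε)) ∧
            ∃ x ∈ QGC.code PU ε (G ω) (B ω),
              (fun i => (x i, Y ω i)) ∈ QGC.typicalSet (QGC.pairLaw PX W) ε n ∧
              x ≠ QGC.codeword (G ω) (B ω) u₀} < δ := by
  have hPQ' (q : 𝒬) : PQ q ≠ 0 := (hPQ q).ne'
  have hD := QGC.slack_pos PQ PU PX W hc.le
  refine ⟨fun ε => -(4 * (QGC.slack PQ PU PX W c * ε)), ?_, fun ε hε δ hδ => ?_⟩
  · have hη : Continuous fun ε => -(4 * (QGC.slack PQ PU PX W c * ε)) := by fun_prop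
    simpa only [mul_zero, neg_zero] using (hη.tendsto 0).mono_left nhdsWithin_le_nhds
  have hlong := QGC.eventually_forall_le_of_abs_sub_le
    (fun q => QGC.toReal_pos_of_ne_zero (hPQ' q)) hc (((p : ℝ) ^ r) ^ 3 / (2 * ε ^ 2))
  have hsmall := (QGC.tendsto_const_mul_two_rpow_sub_mul (mul_pos hD hε) (r + 1)
    (2 * QGC.roundingError PU ε)).eventually_lt_const hδ
  obtain ⟨N, hN⟩ := Filter.eventually_atTop.1 (hlong.and hsmall)
  refine ⟨N, fun n hn k hk u₀ hu₀ Ω _ μ _ G B Y hGB hY => lt_of_le_of_lt ?_ (hN n hn.le).2⟩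
  have hk' (q : 𝒬) : |(k q : ℝ) - c * n * (PQ q).toReal| ≤ 1 := (hk q).le
  refine le_trans ?_ (QGC.measureReal_rate_lt_and_exists_typical_le hc.le hε hPQ'
    (Nat.ne_zero_of_lt hn) hk' ((hN n hn.le).1 k hk') hu₀ hGB hY)
  refine MeasureTheory.measureReal_mono fun ω hω => ⟨fun s hs => ?_, hω.2⟩
  exact hω.1 s (QGC.lt_of_mem_activeLevels hs) (QGC.truncEntropy_pos_of_mem_activeLevels hs).ne'
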